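/- Let $n,N\ge 1$, let $u$ be a real function of $t$ and $x=(x^1,\dots,x^n)$, and consider the scalar PDE in $N$-th order Cauchy–Kovalevskaya form $$G:=\partial_t^N u+g=0, \qquad (1)$$ where $g$ is a smooth function of $t,x,u$ and finitely many derivatives $\partial_t^j\partial_x^\alpha u$ of $u$ with $j<N$. A *differential function* is a smooth real function on the space of jets $(t,x,(\partial_t^j\partial_x^\alpha u)_{j,\alpha})$ depending on finitely many of these coordinates; it is *normal* if it does not depend on any $\partial_t^j\partial_x^\alpha u$ with $j\ge N$ (that is, on $\partial_t^N u$ and its differential consequences). $D_t$ and $D_i$ denote total derivatives, $D_x^\alpha=D_1^{\alpha_1}\cdots D_n^{\alpha_n}$, and repeated indices $i,j$ are summed from $1$ to $n$. The *solution space* of (1) is the set of jets at which $G$ and all its differential consequences $D_t^jD_x^\alpha G$ vanish (the jets of formal solutions). A *conservation law* consists of normal differential functions $\Phi^t,\Phi^1,\dots,\Phi^n$ with $D_t\Phi^t+D_i\Phi^i=0$ on the solution space. It is *trivial* if there are normal differential functions $\theta^i$ and $\psi^{ij}=-\psi^{ji}$ with $\Phi^t=D_i\theta^i$ and $\Phi^i=-D_t\theta^i+D_j\psi^{ij}$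 on the solution space. Two conservation laws are regarded as the same if their difference is trivial. Let $$\hat E(\Phi)=\sum_{\alpha}(-1)^{|\alpha|}D_x^\alpha\left(\frac{\partial\Phi}{\partial(\partial_t^{N-1}\partial_x^\alpha u)}\right)$$ be the restricted Euler operator with respect to $\partial_t^{N-1}u$ and its $x$-derivatives. A *multiplier* of a conservation law $(\Phi^t,\Phi^i)$ is a normal differential function $\Lambda$ for which there are functions $\Gamma^i$, each a finite linear combination of $G$ and its differential consequences $D_t^jD_x^\alpha G$ with differential functions as coefficients, such that, identically on the whole jet space (i.e. for all functions $u$), $$(\partial_t^N u+g)\,\Lambda=D_t\Phi^t+D_i(\Phi^i-\Gamma^i).$$ **Theorem.** Every conservation law $(\Phi^t,\Phi^i)$ of (1) has exactly one multiplier, namely $\Lambda=\hat E(\Phi^t)$. The conservation law is nontrivial if and only if $\Lambda$ is not identically zero, and two conservation laws are the same if and only if their multipliers are equal. In particular, every nontrivial conservation law is uniquely characterized by its multiplier. -/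

import Mathlib

open scoped ContDiff

namespace ConsLaw

/-- Coordinates on the infinite jet space of one real dependent variable `u` and the independent
variables `t, x¹, …, xⁿ`.  `u j α` is the coordinate `∂_t^j ∂_x^α u`, with `α` a multi-index. -/
inductive JetVar (n : ℕ) : Type
  | t : JetVar n
  | x (i : Fin n) : JetVar n
  | u (j : ℕ) (α : Fin n → ℕ) : JetVar n
  deriving DecidableEq

/-- A point of the infinite jet space: a point `(t, x)` together with values there of `u` and all
its derivatives.  Every finite part of it is realized by a (polynomial) function `u(t, x)`, so
an identity between differential functions holds for all functions `u(t, x)` exactly if it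
holds at all points of `Jet n`. -/
abbrev Jet (n : ℕ) : Type := JetVar n → ℝ

variable {n : ℕ}

/-- `F` is a smooth function of finitely many jet coordinates, all of them taken from `V`. -/
def IsDiffFunOf (V : Set (JetVar n)) (F : Jet n → ℝ) : Prop :=
  ∃ S : Finset (JetVar n), (S : Set (JetVar n)) ⊆ V ∧
    ∃ f : (S → ℝ) → ℝ, ContDiff ℝ ∞ f ∧ ∀ z : Jet n, F z = f (fun v => z v)

/-- A differential function: an expression `F(t, x, u, ∂u, …, ∂^k u)`, smooth, of some
finite order. -/
def IsDiffFun (F : Jet n → ℝ) : Prop := IsDiffFunOf Set.univ F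

/-- The coordinates other than `∂_t^N u` and its differential consequences. -/
def normalVars (n N : ℕ) : Set (JetVar n) :=
  {v | ∀ j α, v = JetVar.u j α → j < N}

/-- A differential function with no dependence on `∂_t^N u` and its differential consequences. -/
def IsNormal (N : ℕ) (F : Jet n → ℝ) : Prop := IsDiffFunOf (normalVars n N) F

/-- Partial derivative with respect to one jet coordinate. -/
noncomputable def pd (v : JetVar n) (F : Jet n → ℝ) : Jet n → ℝ :=
  fun z => deriv (fun s : ℝ => F (Function.update z v s)) (z v)

/-- Total derivative `D_t`.  The sum is finite on differential functions. -/
noncomputable def Dt (F : Jet n → ℝ) : Jet n → ℝ :=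
  fun z => pd JetVar.t F z +
    ∑ᶠ p : ℕ × (Fin n → ℕ), z (JetVar.u (p.1 + 1) p.2) * pd (JetVar.u p.1 p.2) F z

/-- Total derivative `D_i`. -/
noncomputable def Dx (i : Fin n) (F : Jet n → ℝ) : Jet n → ℝ :=
  fun z => pd (JetVar.x i) F z +
    ∑ᶠ p : ℕ × (Fin n → ℕ), z (JetVar.u p.1 (p.2 + Pi.single i 1)) * pd (JetVar.u p.1 p.2) F z

/-- `D_x^α = D_1^{α_1} ⋯ D_n^{α_n}`. -/
noncomputable def DxPow (α : Fin n → ℕ) (F : Jet n → ℝ) : Jet n → ℝ :=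
  (List.finRange n).foldr (fun i H => (Dx i)^[α i] H) F

/-- The restricted Euler operator with respect to `∂_t^r u` and its `x`-derivatives,
`∑_α (-1)^{|α|} D_x^α (∂ / ∂(∂_t^r ∂_x^α u))`, the sum being over multi-indices. -/
noncomputable def restrictedEuler (r : ℕ) (F : Jet n → ℝ) : Jet n → ℝ :=
  fun z => ∑ᶠ α : Fin n → ℕ, (-1 : ℝ) ^ (∑ i, α i) * DxPow α (pd (JetVar.u r α) F) z

/-- The left side `G = ∂_t^N u + g` of the PDE. -/
def pde (N : ℕ) (g : Jet n → ℝ) : Jet n → ℝ := fun z => z (JetVar.u N 0) + g z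

/-- The differential consequence `D_t^j D_x^α G` of `G = ∂_t^N u + g`. -/
noncomputable def pdeCons (N : ℕ) (g : Jet n → ℝ) (j : ℕ) (α : Fin n → ℕ) : Jet n → ℝ :=
  Dt^[j] (DxPow α (pde N g))

/-- The solution space of the PDE in jet space: the jets that satisfy `∂_t^N u + g = 0` and all
its differential consequences (the jets of formal solutions at a point). -/
def solutionSpace (N : ℕ) (g : Jet n → ℝ) : Set (Jet n) :=
  {z | ∀ j α, pdeCons N g j α z = 0}

/-- `Φt`, `Φx` are the conserved densities of a local conservation law in normal form:
`D_t Φ^t + D_i Φ^i = 0` on the solution space. -/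
structure IsConservationLaw (N : ℕ) (g : Jet n → ℝ) (Φt : Jet n → ℝ) (Φx : Fin n → Jet n → ℝ) :
    Prop where
  normal_t : IsNormal N Φt
  normal_x : ∀ i, IsNormal N (Φx i)
  conserved : ∀ z ∈ solutionSpace N g, Dt Φt z + ∑ i, Dx i (Φx i) z = 0

/-- Trivial densities: on the solution space `Φ^t = D_i θ^i` and
`Φ^i = - D_t θ^i + D_j ψ^{ij}`, with `ψ^{ij} = - ψ^{ji}`. -/
def IsTrivial (N : ℕ) (g : Jet n → ℝ) (Φt : Jet n → ℝ) (Φx : Fin n → Jet n → ℝ) : Prop :=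
  ∃ (θ : Fin n → Jet n → ℝ) (ψ : Fin n → Fin n → Jet n → ℝ),
    (∀ i, IsNormal N (θ i)) ∧ (∀ i j, IsNormal N (ψ i j)) ∧ (∀ i j, ψ i j = -ψ j i) ∧
    ∀ z ∈ solutionSpace N g,
      Φt z = ∑ i, Dx i (θ i) z ∧ ∀ i, Φx i z = -Dt (θ i) z + ∑ j, Dx j (ψ i j) z

/-- Densities that agree to within trivial ones; they define the same conservation law. -/
def SameLaw (N : ℕ) (g : Jet n → ℝ) (Φt : Jet n → ℝ) (Φx : Fin n → Jet n → ℝ)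
    (Φt' : Jet n → ℝ) (Φx' : Fin n → Jet n → ℝ) : Prop :=
  IsTrivial N g (Φt - Φt') (fun i => Φx i - Φx' i)

/-- `Γ` is proportional to `∂_t^N u + g` and its differential consequences: a finite linear
combination of them whose coefficients are differential functions. -/
def IsProportionalToPDE (N : ℕ) (g : Jet n → ℝ) (Γ : Jet n → ℝ) : Prop :=
  ∃ (S : Finset (ℕ × (Fin n → ℕ))) (c : ℕ × (Fin n → ℕ) → Jet n → ℝ),
    (∀ p, IsDiffFun (c p)) ∧ ∀ z, Γ z = ∑ p ∈ S, c p z * pdeCons N g p.1 p.2 z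

/-- `Λ` is a multiplier, with no dependence on `∂_t^N u` and its differential consequences, for
the densities `Φt`, `Φx`: for all functions `u`,
`(∂_t^N u + g) Λ = D_t Φ^t + D_i (Φ^i - Γ^i)`,
where the `Γ^i` are proportional to `∂_t^N u + g` and its differential consequences. -/
def IsMultiplier (N : ℕ) (g : Jet n → ℝ) (Φt : Jet n → ℝ) (Φx : Fin n → Jet n → ℝ)
    (Λ : Jet n → ℝ) : Prop :=
  IsNormal N Λ ∧ ∃ Γ : Fin n → Jet n → ℝ, (∀ i, IsProportionalToPDE N g (Γ i)) ∧
    ∀ z, pde N g z * Λ z = Dt Φt z + ∑ i, Dx i (Φx i - Γ i) z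

end ConsLaw

/-! The solution space is a graph over the normal coordinates: the PDE and its differential
consequences express every `∂_t^j ∂_x^α u` with `j ≥ N` through them (`proj`, `proj_mem`). Hence
normal functions that agree on the solution space agree everywhere
(`IsNormal.eq_of_eqOn_solutionSpace`).

Existence. For normal `Φ^t` the derivative `D_t Φ^t` contains `D_x^α ∂_t^N u` only linearly, with
coefficient `∂Φ^t/∂(∂_t^{N-1} ∂_x^α u)`. Writing `D_x^α ∂_t^N u = D_x^α G - D_x^α g` leaves a normal
remainder `R` (`exists_totD_none_eq`). The normal function `R + D_i Φ^i` vanishes on the solution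
space, hence identically. Integration by parts in the terms with `D_x^α G` produces `G Ê(Φ^t)` and a
spatial divergence of multiples of the consequences of `G` (`exists_multiplier_identity`).

Uniqueness. The restricted Euler operator for `∂_t^N u` kills each `D_i`, sends `D_t Φ^t` to
`Ê(Φ^t)` and sends `G Λ` to `Λ`; apply it to the multiplier identity (`multiplier_unique`).

Triviality. If the law is trivial, `Φ^t = D_i θ^i` holds identically by normality, so `Ê(Φ^t) = 0`.
Conversely, if `Ê(Φ^t) = 0`, the current `(Φ^t, Φ^i - Γ^i)` is divergence-free on the whole jet
space, hence a total curl (`exists_curl`). Its potentials need not be normal; pulling them back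
along the projection makes them so without changing their total derivatives on the solution space,
to which total derivatives are tangent (`tot_pullback`). There `Γ^i` vanishes, which gives
triviality.

The curl lemma is proved by linearization. The Fréchet derivatives of a divergence-free current form
a divergence-free family of linear operators, which is a curl by a homotopy in the symbol
(`exists_symbolCurl`). Integrating along `s ↦ s u` recovers the current up to its value at `u = 0`,
and that part falls to the classical Poincaré lemma in `(t, x)`. Here `n ≥ 1` is essential: for `n =
0` the constant density `Φ^t = 1` has zero multiplier but is not trivial. -/

namespace ConsLaw

open MeasureTheory intervalIntegral

/-! ### Smooth dependence of integrals on parameters -/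

section ParametricIntegral

variable {E : Type} [NormedAddCommGroup E] [NormedSpace ℝ E] [ProperSpace E]

theorem hasFDerivAt_parametric_integral {F : Type} [NormedAddCommGroup F] [NormedSpace ℝ F]
    [CompleteSpace F]
    {h : E × ℝ → F} (hh : ContDiff ℝ 1 h) (y : E) :
    HasFDerivAt (fun y => ∫ s in (0 : ℝ)..1, h (y, s))
      (∫ s in (0 : ℝ)..1, (fderiv ℝ h (y, s)).comp (ContinuousLinearMap.inl ℝ E ℝ)) y := by
  have hc : Continuous fun p : E × ℝ =>
      (fderiv ℝ h p).comp (ContinuousLinearMap.inl ℝ E ℝ) :=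
    (hh.continuous_fderiv one_ne_zero).clm_comp continuous_const
  -- Compactness of the closed ball times `[0, 1]` supplies the constant that dominates the
  -- derivative.
  obtain ⟨C, hC⟩ := ((isCompact_closedBall y 1).prod
    (isCompact_Icc (a := (0 : ℝ)) (b := 1))).exists_bound_of_continuousOn hc.continuousOn
  refine (hasFDerivAt_integral_of_dominated_of_fderiv_le (μ := volume)
    (bound := fun _ => C) (s := Metric.ball y 1)
    (F' := fun y s => (fderiv ℝ h (y, s)).comp (ContinuousLinearMap.inl ℝ E ℝ))
    (Metric.ball_mem_nhds y one_pos) ?_ ?_ ?_ ?_ ?_ ?_)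
  · exact .of_forall fun x =>
      (hh.continuous.comp (by fun_prop : Continuous fun s : ℝ => (x, s))).aestronglyMeasurable
  · exact (hh.continuous.comp (by fun_prop : Continuous fun s : ℝ => (y, s))).intervalIntegrable _ _
  · exact (hc.comp (by fun_prop : Continuous fun s : ℝ => (y, s))).aestronglyMeasurable
  · refine .of_forall fun s hs x hx => hC (x, s) ⟨Metric.ball_subset_closedBall hx, ?_⟩
    rw [Set.uIoc_of_le zero_le_one] at hs
    exact ⟨hs.1.le, hs.2⟩
  · exact continuous_const.intervalIntegrable _ _
  · refine .of_forall fun s _ x _ => ?_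
    exact (hh.differentiable one_ne_zero (x, s)).hasFDerivAt.comp x
      (hasFDerivAt_prodMk_left (𝕜 := ℝ) x s)

/-- The derivative is again an integral of this kind, with values in a space of linear maps; the
induction on `k` therefore has to run over all target spaces at once. -/
theorem contDiff_parametric_integral_nat (k : ℕ) :
    ∀ {F : Type} [NormedAddCommGroup F] [NormedSpace ℝ F] [CompleteSpace F] {h : E × ℝ → F},
      ContDiff ℝ ∞ h → ContDiff ℝ k (fun y => ∫ s in (0 : ℝ)..1, h (y, s)) := by
  induction k with
  | zero =>
    intro F _ _ _ h hh
    exact contDiff_zero.2 (continuous_parametric_intervalIntegral_of_continuous'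
      (f := fun y s => h (y, s)) hh.continuous 0 1)
  | succ k ih =>
    intro F _ _ _ h hh
    rw [Nat.cast_succ, contDiff_succ_iff_hasFDerivAt]
    refine ⟨_, ih (h := fun p => (fderiv ℝ h p).comp (ContinuousLinearMap.inl ℝ E ℝ)) ?_,
      fun y => hasFDerivAt_parametric_integral (hh.of_le (by exact_mod_cast le_top)) y⟩
    exact (hh.fderiv_right (m := ∞) (by simp)).clm_comp contDiff_const

/-- An integral over a compact interval depends smoothly on parameters. -/
theorem contDiff_parametric_integral {F : Type} [NormedAddCommGroup F] [NormedSpace ℝ F]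
    [CompleteSpace F] {h : E × ℝ → F} (hh : ContDiff ℝ ∞ h) :
    ContDiff ℝ ∞ (fun y => ∫ s in (0 : ℝ)..1, h (y, s)) :=
  contDiff_infty.2 fun k => contDiff_parametric_integral_nat k hh

end ParametricIntegral

variable {n : ℕ}

/-! ### Smooth functions of a fixed finite set of jet coordinates -/

/-- `F` is a smooth function of the jet coordinates in `S`. -/
def IsSmoothIn (S : Finset (JetVar n)) (F : Jet n → ℝ) : Prop :=
  ∃ f : (S → ℝ) → ℝ, ContDiff ℝ ∞ f ∧ ∀ z : Jet n, F z = f (fun v => z v)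

theorem isDiffFunOf_iff {V : Set (JetVar n)} {F : Jet n → ℝ} :
    IsDiffFunOf V F ↔ ∃ S : Finset (JetVar n), (S : Set (JetVar n)) ⊆ V ∧ IsSmoothIn S F :=
  Iff.rfl

namespace IsSmoothIn

variable {S T : Finset (JetVar n)} {F : Jet n → ℝ}

theorem mono (hF : IsSmoothIn S F) (h : S ⊆ T) : IsSmoothIn T F := by
  obtain ⟨f, hf, hF⟩ := hF
  refine ⟨fun y => f (fun v => y ⟨v, h v.2⟩), hf.comp ?_, hF⟩
  exact contDiff_pi.2 fun v => contDiff_apply ℝ ℝ _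

theorem coord {v : JetVar n} (hv : v ∈ S) : IsSmoothIn S (fun z => z v) :=
  ⟨fun y => y ⟨v, hv⟩, contDiff_apply ℝ ℝ _, fun _ => rfl⟩

theorem comp {ι : Type*} [Fintype ι] {f : (ι → ℝ) → ℝ} (hf : ContDiff ℝ ∞ f)
    {h : ι → Jet n → ℝ} (hh : ∀ i, IsSmoothIn S (h i)) :
    IsSmoothIn S (fun z => f (fun i => h i z)) := by
  choose k hk hh using hh
  exact ⟨fun y => f (fun i => k i y), hf.comp (contDiff_pi.2 hk), fun z => by simp only [hh]⟩

theorem const (c : ℝ) : IsSmoothIn S (fun _ => c) := ⟨fun _ => c, contDiff_const, fun _ => rfl⟩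

theorem add {G : Jet n → ℝ} (hF : IsSmoothIn S F) (hG : IsSmoothIn S G) :
    IsSmoothIn S (F + G) := by
  obtain ⟨f, hf, hF⟩ := hF
  obtain ⟨g, hg, hG⟩ := hG
  exact ⟨f + g, hf.add hg, fun z => by simp [hF, hG]⟩

theorem mul {G : Jet n → ℝ} (hF : IsSmoothIn S F) (hG : IsSmoothIn S G) :
    IsSmoothIn S (F * G) := by
  obtain ⟨f, hf, hF⟩ := hF
  obtain ⟨g, hg, hG⟩ := hG
  exact ⟨f * g, hf.mul hg, fun z => by simp [hF, hG]⟩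

theorem dependsOn (hF : IsSmoothIn S F) {z z' : Jet n} (h : ∀ v ∈ S, z v = z' v) :
    F z = F z' := by
  obtain ⟨f, -, hF⟩ := hF
  rw [hF, hF]
  exact congrArg f (funext fun v => h v v.2)

theorem pd_eq_zero (hF : IsSmoothIn S F) {v : JetVar n} (hv : v ∉ S) : pd v F = 0 := by
  funext z
  have : (fun s : ℝ => F (Function.update z v s)) = fun _ => F z := by
    funext s
    exact hF.dependsOn fun w hw => Function.update_of_ne (by rintro rfl; exact hv hw) _ _
  simp [pd, this]

theorem hasDerivAt_curve_aux {f : (S → ℝ) → ℝ} (hf : ContDiff ℝ ∞ f)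
    (hF : ∀ z : Jet n, F z = f (fun v => z v))
    {γ : ℝ → Jet n} {w : Jet n} {s₀ : ℝ} (hγ : ∀ v ∈ S, HasDerivAt (fun s => γ s v) (w v) s₀) :
    HasDerivAt (fun s => F (γ s)) (fderiv ℝ f (fun v => γ s₀ v) (fun v => w v)) s₀ := by
  have h1 : HasDerivAt (fun s => fun v : S => γ s v) (fun v : S => w v) s₀ :=
    hasDerivAt_pi.2 fun v => hγ v v.2
  have h2 := ((hf.differentiable (by simp)) (fun v : S => γ s₀ v)).hasFDerivAt.comp_hasDerivAt s₀ h1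
  simpa only [Function.comp_def, ← hF] using h2

theorem hasDerivAt_update_coord (z : Jet n) (v w : JetVar n) :
    HasDerivAt (fun s => Function.update z v s w) ((Pi.single v 1 : Jet n) w) (z v) := by
  by_cases h : w = v
  · subst h
    simpa only [Function.update_self, Pi.single_eq_same] using hasDerivAt_id' (z w)
  · simpa [h] using hasDerivAt_const _ _

theorem pd_eq_fderiv {f : (S → ℝ) → ℝ} (hf : ContDiff ℝ ∞ f)
    (hF : ∀ z : Jet n, F z = f (fun v => z v)) (v : S) (z : Jet n) :
    pd v F z = fderiv ℝ f (fun v => z v) (Pi.single v 1) := by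
  have := hasDerivAt_curve_aux hf hF (γ := fun s => Function.update z v s)
    (w := Pi.single (v : JetVar n) 1) (s₀ := z v) (fun w _ => hasDerivAt_update_coord z v w)
  rw [pd, this.deriv, Function.update_eq_self]
  congr 1
  funext w
  rcases eq_or_ne w v with rfl | h
  · simp
  · rw [Pi.single_eq_of_ne h, Pi.single_eq_of_ne (Subtype.coe_ne_coe.2 h)]

theorem pd (hF : IsSmoothIn S F) (v : JetVar n) : IsSmoothIn S (pd v F) := by
  by_cases hv : v ∈ S
  · obtain ⟨f, hf, hF⟩ := hF
    exact ⟨fun y => fderiv ℝ f y (Pi.single ⟨v, hv⟩ 1),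
      (hf.fderiv_right (m := ∞) (by simp)).clm_apply contDiff_const,
      fun z => pd_eq_fderiv hf hF ⟨v, hv⟩ z⟩
  · rw [hF.pd_eq_zero hv]
    exact const 0

/-- The chain rule along a curve in jet space. -/
theorem hasDerivAt_curve (hF : IsSmoothIn S F)
    {γ : ℝ → Jet n} {w : Jet n} {s₀ : ℝ} (hγ : ∀ v ∈ S, HasDerivAt (fun s => γ s v) (w v) s₀) :
    HasDerivAt (fun s => F (γ s)) (∑ v ∈ S, w v * ConsLaw.pd v F (γ s₀)) s₀ := by
  obtain ⟨f, hf, hF⟩ := hF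
  convert hasDerivAt_curve_aux hf hF hγ using 1
  rw [← Finset.sum_coe_sort, ← ContinuousLinearMap.coe_coe, LinearMap.pi_apply_eq_sum_univ]
  refine Finset.sum_congr rfl fun v _ => ?_
  rw [pd_eq_fderiv hf hF, smul_eq_mul]
  refine congrArg (fun y => w v * fderiv ℝ f _ y) (funext fun i => ?_)
  simp [Pi.single_apply, eq_comm]

theorem hasDerivAt_update (hF : IsSmoothIn S F) (v : JetVar n) (z : Jet n) :
    HasDerivAt (fun s => F (Function.update z v s)) (ConsLaw.pd v F z) (z v) := by
  obtain ⟨f, hf, hF⟩ := hF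
  refine (hasDerivAt_curve_aux hf hF (γ := fun s => Function.update z v s)
    (w := Pi.single (v : JetVar n) 1) (s₀ := z v)
    (fun w _ => hasDerivAt_update_coord z v w)).differentiableAt.hasDerivAt

theorem pd_comm (hF : IsSmoothIn S F) (v w : JetVar n) :
    ConsLaw.pd v (ConsLaw.pd w F) = ConsLaw.pd w (ConsLaw.pd v F) := by
  by_cases hv : v ∈ S; swap
  · rw [hF.pd_eq_zero hv, (hF.pd w).pd_eq_zero hv]; funext z; simp [ConsLaw.pd]
  by_cases hw : w ∈ S; swap
  · rw [hF.pd_eq_zero hw, (hF.pd v).pd_eq_zero hw]; funext z; simp [ConsLaw.pd]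
  obtain ⟨f, hf, hF⟩ := hF
  have key : ∀ a b : S, ∀ z, ConsLaw.pd a (ConsLaw.pd b F) z =
      fderiv ℝ (fderiv ℝ f) (fun v => z v) (Pi.single a 1) (Pi.single b 1) := by
    intro a b z
    have h1 : ContDiff ℝ ∞ (fderiv ℝ f) := hf.fderiv_right (m := ∞) (by simp)
    rw [pd_eq_fderiv (f := fun y => fderiv ℝ f y (Pi.single b 1))
      (h1.clm_apply contDiff_const) (pd_eq_fderiv hf hF b)]
    rw [fderiv_clm_apply (h1.differentiable (by simp) _) (by fun_prop)]
    simp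
  funext z
  rw [key ⟨v, hv⟩ ⟨w, hw⟩, key ⟨w, hw⟩ ⟨v, hv⟩]
  exact (hf.contDiffAt.isSymmSndFDerivAt (by
    simp only [minSmoothness_of_isRCLikeNormedField]
    exact WithTop.coe_le_coe.2 (le_top : (2 : ℕ∞) ≤ ⊤))).eq _ _

end IsSmoothIn

namespace IsDiffFunOf

variable {V W : Set (JetVar n)} {F G : Jet n → ℝ}

theorem mono (hF : IsDiffFunOf V F) (h : V ⊆ W) : IsDiffFunOf W F := by
  obtain ⟨S, hS, hF⟩ := hF
  exact ⟨S, hS.trans h, hF⟩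

theorem coord {v : JetVar n} (hv : v ∈ V) : IsDiffFunOf V (fun z => z v) :=
  isDiffFunOf_iff.2 ⟨{v}, by simpa using hv, .coord (by simp)⟩

theorem const (c : ℝ) : IsDiffFunOf V (fun _ => c) :=
  isDiffFunOf_iff.2 ⟨∅, by simp, .const c⟩

theorem common_support {ι : Type*} [Fintype ι] {h : ι → Jet n → ℝ}
    (hh : ∀ i, IsDiffFunOf V (h i)) :
    ∃ S : Finset (JetVar n), (S : Set (JetVar n)) ⊆ V ∧ ∀ i, IsSmoothIn S (h i) := by
  choose T hT hh using hh
  exact ⟨Finset.univ.biUnion T, by simpa using hT, fun i =>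
    IsSmoothIn.mono (hh i) (Finset.subset_biUnion_of_mem T (Finset.mem_univ i))⟩

theorem comp {ι : Type*} [Fintype ι] {f : (ι → ℝ) → ℝ} (hf : ContDiff ℝ ∞ f)
    {h : ι → Jet n → ℝ} (hh : ∀ i, IsDiffFunOf V (h i)) :
    IsDiffFunOf V (fun z => f (fun i => h i z)) := by
  obtain ⟨S, hS, hh⟩ := common_support hh
  exact ⟨S, hS, IsSmoothIn.comp hf hh⟩

theorem add (hF : IsDiffFunOf V F) (hG : IsDiffFunOf V G) : IsDiffFunOf V (F + G) := by
  obtain ⟨S, hS, h⟩ := common_support (h := fun b : Bool => cond b F G)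
    (by rintro (_ | _) <;> assumption)
  exact ⟨S, hS, (h true).add (h false)⟩

theorem mul (hF : IsDiffFunOf V F) (hG : IsDiffFunOf V G) : IsDiffFunOf V (F * G) := by
  obtain ⟨S, hS, h⟩ := common_support (h := fun b : Bool => cond b F G)
    (by rintro (_ | _) <;> assumption)
  exact ⟨S, hS, (h true).mul (h false)⟩

theorem dependsOn (hF : IsDiffFunOf V F) {z z' : Jet n} (h : ∀ v ∈ V, z v = z' v) :
    F z = F z' := by
  obtain ⟨S, hS, hF⟩ := isDiffFunOf_iff.1 hF
  exact hF.dependsOn fun v hv => h v (hS hv)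

theorem pd (hF : IsDiffFunOf V F) (v : JetVar n) : IsDiffFunOf V (pd v F) := by
  obtain ⟨S, hS, hF⟩ := isDiffFunOf_iff.1 hF
  exact ⟨S, hS, hF.pd v⟩

theorem pd_eq_zero (hF : IsDiffFunOf V F) {v : JetVar n} (hv : v ∉ V) : ConsLaw.pd v F = 0 := by
  obtain ⟨S, hS, hF⟩ := isDiffFunOf_iff.1 hF
  exact hF.pd_eq_zero fun h => hv (hS h)

end IsDiffFunOf

/-! ### The algebra of differential functions and its derivations -/

variable (n) in
/-- The algebra of differential functions. -/
def diffAlg : Subalgebra ℝ (Jet n → ℝ) where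
  carrier := {F | IsDiffFun F}
  mul_mem' := IsDiffFunOf.mul
  add_mem' := IsDiffFunOf.add
  algebraMap_mem' c := IsDiffFunOf.const c

variable (n) in
/-- Differential functions. -/
abbrev DF : Type := diffAlg n

theorem DF.exists_support (F : DF n) : ∃ S, IsSmoothIn S (F : Jet n → ℝ) := by
  obtain ⟨S, -, hS⟩ := isDiffFunOf_iff.1 F.2
  exact ⟨S, hS⟩

theorem DF.exists_support₂ (F G : DF n) :
    ∃ S, IsSmoothIn S (F : Jet n → ℝ) ∧ IsSmoothIn S (G : Jet n → ℝ) := by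
  obtain ⟨S, hS⟩ := F.exists_support
  obtain ⟨T, hT⟩ := G.exists_support
  exact ⟨S ∪ T, hS.mono Finset.subset_union_left, hT.mono Finset.subset_union_right⟩

theorem DF.hasDerivAt_update (F : DF n) (v : JetVar n) (z : Jet n) :
    HasDerivAt (fun s => (F : Jet n → ℝ) (Function.update z v s)) (pd v F z) (z v) := by
  obtain ⟨S, hS⟩ := F.exists_support
  exact hS.hasDerivAt_update v z

/-- Partial derivatives, as derivations of the algebra of differential functions. -/
noncomputable def pdD (v : JetVar n) : Derivation ℝ (DF n) (DF n) :=
  Derivation.mk'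
    { toFun := fun F => ⟨pd v F, F.2.pd v⟩
      map_add' := fun F G => Subtype.ext <| funext fun z =>
        ((F.hasDerivAt_update v z).add (G.hasDerivAt_update v z)).deriv
      map_smul' := fun c F => Subtype.ext <| funext fun z =>
        ((F.hasDerivAt_update v z).const_smul c).deriv }
    fun F G => Subtype.ext <| funext fun z => by
      refine ((F.hasDerivAt_update v z).mul (G.hasDerivAt_update v z)).deriv.trans ?_
      simp only [Function.update_eq_self]
      change _ = (F : Jet n → ℝ) z * pd v G z + (G : Jet n → ℝ) z * pd v F z
      ring

@[simp] theorem coe_pdD (v : JetVar n) (F : DF n) : (pdD v F : Jet n → ℝ) = pd v F := rfl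

theorem pdD_comm (v w : JetVar n) (F : DF n) : pdD v (pdD w F) = pdD w (pdD v F) := by
  obtain ⟨S, hS⟩ := F.exists_support
  exact Subtype.ext (hS.pd_comm v w)

theorem pdD_eq_zero {S : Finset (JetVar n)} {F : DF n} (hF : IsSmoothIn S (F : Jet n → ℝ))
    {v : JetVar n} (hv : v ∉ S) : pdD v F = 0 :=
  Subtype.ext (hF.pd_eq_zero hv)

/-- The coordinate functions on jet space. -/
def coordD (v : JetVar n) : DF n := ⟨fun z => z v, IsDiffFunOf.coord trivial⟩

@[simp] theorem coordD_apply (v : JetVar n) (z : Jet n) : (coordD v : Jet n → ℝ) z = z v := rfl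

theorem pdD_coordD (v w : JetVar n) : pdD v (coordD w) = if v = w then 1 else 0 := by
  refine Subtype.ext (funext fun z => ?_)
  have h := (IsSmoothIn.hasDerivAt_update_coord z v w).deriv
  change pd v (fun z => z w) z = _
  rw [pd, h, Pi.single_apply]
  simp only [eq_comm (a := w)]
  split_ifs <;> rfl

/-! ### Multi-indices in all independent variables -/

/-- Multi-indices for derivatives with respect to all of `t, x¹, …, xⁿ`; `none` stands for `t`. -/
abbrev MIdx (n : ℕ) : Type := Option (Fin n) → ℕ

/-- The jet coordinate `∂^β u`. -/
def uvar (β : MIdx n) : JetVar n := .u (β none) (fun i => β (some i))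

/-- The multi-index of `∂_t^j ∂_x^α`. -/
def midx (j : ℕ) (α : Fin n → ℕ) : MIdx n := fun o => o.elim j α

/-- The coordinate of an independent variable. -/
def bvar : Option (Fin n) → JetVar n
  | none => .t
  | some i => .x i

@[simp] theorem midx_none (j : ℕ) (α : Fin n → ℕ) : midx j α none = j := rfl
@[simp] theorem midx_some (j : ℕ) (α : Fin n → ℕ) (i : Fin n) : midx j α (some i) = α i := rfl

@[simp] theorem uvar_midx (j : ℕ) (α : Fin n → ℕ) : uvar (midx j α) = .u j α := rfl

@[simp] theorem midx_eta (β : MIdx n) : midx (β none) (fun i => β (some i)) = β := by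
  funext o; cases o <;> rfl

theorem uvar_injective : Function.Injective (uvar (n := n)) := by
  intro β γ h
  simp only [uvar, JetVar.u.injEq] at h
  rw [← midx_eta β, ← midx_eta γ, h.1, h.2]

@[simp] theorem uvar_inj {β γ : MIdx n} : uvar β = uvar γ ↔ β = γ := uvar_injective.eq_iff

theorem bvar_injective : Function.Injective (bvar (n := n)) := by
  rintro (_ | i) (_ | j) h <;> simp_all [bvar]

@[simp] theorem bvar_ne_uvar (μ : Option (Fin n)) (β : MIdx n) : bvar μ ≠ uvar β := by
  cases μ <;> simp [bvar, uvar]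

@[simp] theorem uvar_ne_bvar (μ : Option (Fin n)) (β : MIdx n) : uvar β ≠ bvar μ :=
  (bvar_ne_uvar μ β).symm

@[elab_as_elim]
theorem JetVar.bvar_uvar_cases {motive : JetVar n → Prop} (v : JetVar n)
    (base : ∀ μ, motive (bvar μ)) (jet : ∀ β, motive (uvar β)) : motive v := by
  cases v with
  | t => exact base none
  | x i => exact base (some i)
  | u j α => exact jet (midx j α)

theorem midx_add_single_none (j : ℕ) (α : Fin n → ℕ) :
    midx j α + Pi.single none 1 = midx (j + 1) α := by
  funext o; cases o <;> simp

theorem midx_add_single_some (j : ℕ) (α : Fin n → ℕ) (i : Fin n) :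
    midx j α + Pi.single (some i) 1 = midx j (α + Pi.single i 1) := by
  funext o; cases o <;> simp [Pi.single_apply]

/-! ### Total derivatives -/

/-- The total derivatives, with `none` standing for `t`. -/
noncomputable def tot : Option (Fin n) → (Jet n → ℝ) → Jet n → ℝ
  | none => Dt
  | some i => Dx i

/-- The total derivatives of the jet coordinates. -/
def totCoord (μ : Option (Fin n)) : JetVar n → DF n
  | .t => if μ = none then 1 else 0
  | .x i => if μ = some i then 1 else 0
  | .u j α => coordD (uvar (midx j α + Pi.single μ 1))

@[simp] theorem totCoord_bvar (μ ν : Option (Fin n)) :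
    totCoord μ (bvar ν) = if μ = ν then 1 else 0 := by
  cases ν <;> rfl

@[simp] theorem totCoord_uvar (μ : Option (Fin n)) (β : MIdx n) :
    totCoord μ (uvar β) = coordD (uvar (β + Pi.single μ 1)) := by
  simp [uvar, totCoord]

theorem sum_eq_bvar_add_finsum (S : Finset (JetVar n)) (h : JetVar n → ℝ)
    (hS : ∀ v ∉ S, h v = 0) :
    ∑ v ∈ S, h v = ∑ μ, h (bvar μ) + ∑ᶠ p : ℕ × (Fin n → ℕ), h (.u p.1 p.2) := by
  classical
  have hinj : Function.Injective fun p : ℕ × (Fin n → ℕ) => JetVar.u p.1 p.2 := by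
    rintro ⟨a, b⟩ ⟨c, d⟩ h; simpa using h
  set P := S.preimage (fun p : ℕ × (Fin n → ℕ) => JetVar.u p.1 p.2) hinj.injOn with hP
  rw [finsum_eq_sum_of_support_subset (s := P) _ (by
      intro p hp
      simp only [hP, Finset.coe_preimage, Set.mem_preimage, Finset.mem_coe]
      by_contra hh
      exact hp (hS _ hh)),
    ← Finset.sum_image (f := h) (g := bvar) bvar_injective.injOn,
    ← Finset.sum_image (f := h) (g := fun p : ℕ × (Fin n → ℕ) => JetVar.u p.1 p.2) hinj.injOn,
    ← Finset.sum_union]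
  · refine Finset.sum_subset (fun v hv => ?_) (fun v _ hv => hS v hv)
    rw [Finset.mem_union, Finset.mem_image, Finset.mem_image]
    cases v with
    | t => exact .inl ⟨none, Finset.mem_univ _, rfl⟩
    | x i => exact .inl ⟨some i, Finset.mem_univ _, rfl⟩
    | u j α => exact .inr ⟨(j, α), by simpa [hP] using hv, rfl⟩
  · rw [Finset.disjoint_left]
    intro v hv hv'
    obtain ⟨μ, -, rfl⟩ := Finset.mem_image.1 hv
    obtain ⟨p, -, h⟩ := Finset.mem_image.1 hv'
    exact bvar_ne_uvar μ (midx p.1 p.2) h.symm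

/-- Treats `D_t` and `D_i` uniformly as vector fields with components `totCoord μ v`, and replaces
the infinite formal sum by one over any finite support of `F`. -/
theorem tot_eq_sum (μ : Option (Fin n)) {S : Finset (JetVar n)} {F : Jet n → ℝ}
    (hF : IsSmoothIn S F) (z : Jet n) :
    tot μ F z = ∑ v ∈ S, (totCoord μ v : Jet n → ℝ) z * pd v F z := by
  rw [sum_eq_bvar_add_finsum S _ fun v hv => by simp [hF.pd_eq_zero hv]]
  have h1 : ∑ ν, (totCoord μ (bvar ν) : Jet n → ℝ) z * pd (bvar ν) F z = pd (bvar μ) F z := by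
    rw [Finset.sum_eq_single μ]
    · simp
    · intro ν _ h
      simp [Ne.symm h]
    · simp
  rw [h1]
  cases μ with
  | none => simp only [totCoord, midx_add_single_none, coordD_apply, uvar_midx]; rfl
  | some i => simp only [totCoord, midx_add_single_some, coordD_apply, uvar_midx]; rfl

theorem tot_mem (μ : Option (Fin n)) (F : DF n) : tot μ F ∈ diffAlg n := by
  obtain ⟨S, hS⟩ := F.exists_support
  have : tot μ F = ((∑ v ∈ S, totCoord μ v * pdD v F : DF n) : Jet n → ℝ) := by
    funext z
    simp [tot_eq_sum μ hS, Finset.sum_apply]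
  rw [this]
  exact Subtype.prop _

theorem totD_aux (μ : Option (Fin n)) {S : Finset (JetVar n)} {F : DF n}
    (hF : IsSmoothIn S (F : Jet n → ℝ)) :
    (⟨tot μ F, tot_mem μ F⟩ : DF n) = ∑ v ∈ S, totCoord μ v * pdD v F := by
  refine Subtype.ext (funext fun z => ?_)
  simp [tot_eq_sum μ hF, Finset.sum_apply]

/-- The total derivatives, as derivations of the algebra of differential functions. -/
noncomputable def totD (μ : Option (Fin n)) : Derivation ℝ (DF n) (DF n) :=
  Derivation.mk'
    { toFun := fun F => ⟨tot μ F, tot_mem μ F⟩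
      map_add' := fun F G => by
        obtain ⟨S, hF, hG⟩ := F.exists_support₂ G
        rw [totD_aux μ hF, totD_aux μ hG, totD_aux μ (F := F + G) (hF.add hG)]
        simp [mul_add, Finset.sum_add_distrib]
      map_smul' := fun c F => by
        obtain ⟨S, hF⟩ := F.exists_support
        rw [totD_aux μ hF, totD_aux μ (F := c • F)
          ((IsSmoothIn.const c).mul hF)]
        simp [Finset.smul_sum] }
    fun F G => by
      obtain ⟨S, hF, hG⟩ := F.exists_support₂ G
      change (⟨_, _⟩ : DF n) = F • (⟨_, _⟩ : DF n) + G • (⟨_, _⟩ : DF n)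
      rw [totD_aux μ hF, totD_aux μ hG, totD_aux μ (F := F * G) (hF.mul hG)]
      simp only [Derivation.leibniz, smul_eq_mul, Finset.mul_sum, ← Finset.sum_add_distrib]
      exact Finset.sum_congr rfl fun v _ => by ring

@[simp] theorem coe_totD (μ : Option (Fin n)) (F : DF n) : (totD μ F : Jet n → ℝ) = tot μ F := rfl

theorem totD_eq_sum (μ : Option (Fin n)) {S : Finset (JetVar n)} {F : DF n}
    (hF : IsSmoothIn S (F : Jet n → ℝ)) :
    totD μ F = ∑ v ∈ S, totCoord μ v * pdD v F :=
  totD_aux μ hF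

theorem totD_coordD (μ : Option (Fin n)) (v : JetVar n) : totD μ (coordD v) = totCoord μ v := by
  rw [totD_eq_sum μ (S := {v}) (.coord (by simp))]
  simp [pdD_coordD]

theorem pdD_totD (v : JetVar n) (μ : Option (Fin n)) {S : Finset (JetVar n)} {F : DF n}
    (hF : IsSmoothIn S (F : Jet n → ℝ)) :
    pdD v (totD μ F) = totD μ (pdD v F) + ∑ w ∈ S, pdD v (totCoord μ w) * pdD w F := by
  rw [totD_eq_sum μ hF, totD_eq_sum μ (F := pdD v F) (hF.pd v), map_sum, ← Finset.sum_add_distrib]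
  refine Finset.sum_congr rfl fun w _ => ?_
  rw [Derivation.leibniz, pdD_comm v w]
  simp only [smul_eq_mul]
  ring

theorem pdD_uvar_totD_of_eq_zero {μ : Option (Fin n)} {γ : MIdx n} (h : γ μ = 0) (F : DF n) :
    pdD (uvar γ) (totD μ F) = totD μ (pdD (uvar γ) F) := by
  obtain ⟨S, hS⟩ := F.exists_support
  rw [pdD_totD _ _ hS, Finset.sum_eq_zero, add_zero]
  intro w _
  induction w using JetVar.bvar_uvar_cases with
  | base κ => rw [totCoord_bvar]; split_ifs <;> simp
  | jet β =>
    have : γ ≠ β + Pi.single μ 1 := by rintro rfl; simp at h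
    simp [pdD_coordD, this]

/-- Among the components of the vector field `D_μ`, only the one along `uvar γ` involves the
coordinate `uvar (γ + Pi.single μ 1)`, so the commutator is a single partial derivative. -/
theorem pdD_uvar_add_single_totD (μ : Option (Fin n)) (γ : MIdx n) (F : DF n) :
    pdD (uvar (γ + Pi.single μ 1)) (totD μ F) =
      totD μ (pdD (uvar (γ + Pi.single μ 1)) F) + pdD (uvar γ) F := by
  classical
  obtain ⟨S, hS⟩ := F.exists_support
  rw [pdD_totD _ _ (hS.mono (Finset.subset_insert (uvar γ) S)), Finset.sum_eq_single (uvar γ)]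
  · simp [pdD_coordD]
  · intro w _ hw
    induction w using JetVar.bvar_uvar_cases with
    | base κ => rw [totCoord_bvar]; split_ifs <;> simp
    | jet β =>
      have : γ ≠ β := by rintro rfl; exact hw rfl
      simp [pdD_coordD, this]
  · simp

/-- The second-order terms are symmetric, and the first-order terms agree because the two orders of
differentiation agree on the coordinates (`key`). -/
theorem totD_comm (μ ν : Option (Fin n)) (F : DF n) :
    totD μ (totD ν F) = totD ν (totD μ F) := by
  have key : ∀ v, totD μ (totCoord ν v) = totD ν (totCoord μ v) := by
    intro v
    induction v using JetVar.bvar_uvar_cases with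
    | base κ => rw [totCoord_bvar, totCoord_bvar]; split_ifs <;> simp
    | jet β => simp [totD_coordD, add_right_comm]
  obtain ⟨S, hS⟩ := F.exists_support
  rw [totD_eq_sum μ hS, totD_eq_sum ν hS, map_sum, map_sum]
  simp only [Derivation.leibniz, smul_eq_mul, Finset.sum_add_distrib, key]
  congr 1
  · simp only [totD_eq_sum _ (F := pdD _ F) (hS.pd _), Finset.mul_sum]
    rw [Finset.sum_comm]
    refine Finset.sum_congr rfl fun v _ => Finset.sum_congr rfl fun w _ => ?_
    rw [pdD_comm v w]
    ring

/-- A total derivative is the derivative along a direction in jet space. -/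
theorem hasDerivAt_tot (μ : Option (Fin n)) (F : DF n) (z : Jet n) :
    HasDerivAt (fun s : ℝ => (F : Jet n → ℝ) (fun v => z v + s * (totCoord μ v : Jet n → ℝ) z))
      (tot μ F z) 0 := by
  obtain ⟨S, hS⟩ := F.exists_support
  have := hS.hasDerivAt_curve (s₀ := 0)
    (γ := fun s v => z v + s * (totCoord μ v : Jet n → ℝ) z)
    (w := fun v => (totCoord μ v : Jet n → ℝ) z)
    fun v _ => by simpa using ((hasDerivAt_id (0 : ℝ)).mul_const _).const_add (z v)
  simpa [← tot_eq_sum μ hS] using this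

/-! ### Divergence-free linear differential operators -/

section LinearCurrents

theorem sum_sum_eq_zero_of_antisymm {ι B : Type*} [Fintype ι] [AddCommGroup B] [Module ℝ B]
    (E : ι → ι → B) (hE : ∀ μ ν, E μ ν = -E ν μ) : ∑ μ, ∑ ν, E μ ν = 0 := by
  have h : ∑ μ, ∑ ν, E μ ν = -∑ μ, ∑ ν, E μ ν := by
    conv_lhs => rw [Finset.sum_comm]
    rw [← Finset.sum_neg_distrib]
    refine Finset.sum_congr rfl fun μ _ => ?_
    rw [← Finset.sum_neg_distrib]
    exact Finset.sum_congr rfl fun ν _ => hE ν μ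
  have h2 : (2 : ℝ) • ∑ μ, ∑ ν, E μ ν = 0 := by
    rw [two_smul]
    nth_rw 1 [h]
    exact neg_add_cancel _
  exact (smul_eq_zero.1 h2).resolve_left two_ne_zero
variable {ι A : Type*} [DecidableEq ι] [AddCommGroup A] [Module ℝ A]

/-- Composition with `D μ` from the left, for differential operators in an indeterminate function
given by their coefficients. -/
noncomputable def nabla (D : ι → A →ₗ[ℝ] A) (μ : ι) : ((ι → ℕ) →₀ A) →ₗ[ℝ] ((ι → ℕ) →₀ A) :=
  Finsupp.mapRange.linearMap (D μ) + Finsupp.lmapDomain A ℝ (· + Pi.single μ 1)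

/-- The formal derivative of the symbol of a differential operator. -/
noncomputable def symbolDeriv (μ : ι) : ((ι → ℕ) →₀ A) →ₗ[ℝ] ((ι → ℕ) →₀ A) :=
  Finsupp.lsum ℝ fun β => (β μ : ℝ) • Finsupp.lsingle (β - Pi.single μ 1)

variable (D : ι → A →ₗ[ℝ] A)

@[simp] theorem nabla_single (μ : ι) (β : ι → ℕ) (a : A) :
    nabla D μ (Finsupp.single β a) =
      Finsupp.single β (D μ a) + Finsupp.single (β + Pi.single μ 1) a := by
  simp [nabla]

@[simp] theorem symbolDeriv_single (μ : ι) (β : ι → ℕ) (a : A) :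
    symbolDeriv μ (Finsupp.single β a) = (β μ : ℝ) • Finsupp.single (β - Pi.single μ 1) a := by
  simp [symbolDeriv]

theorem nabla_comm (hD : ∀ μ ν a, D μ (D ν a) = D ν (D μ a)) (μ ν : ι) (C : (ι → ℕ) →₀ A) :
    nabla D μ (nabla D ν C) = nabla D ν (nabla D μ C) := by
  induction C using Finsupp.induction_linear with
  | zero => simp
  | add C C' h h' => simp [h, h']
  | single β a =>
    simp only [nabla_single, map_add, hD μ ν, add_right_comm β]
    abel

theorem sub_single_add_single {μ : ι} {β : ι → ℕ} (h : β μ ≠ 0) :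
    β - Pi.single μ 1 + Pi.single μ 1 = β :=
  tsub_add_cancel_of_le fun κ => by
    rcases eq_or_ne κ μ with rfl | hκ
    · simpa using Nat.one_le_iff_ne_zero.2 h
    · simp [hκ]

/-- On symbols, composition with `D ν` is `D ν + ξ_ν`, and `∂/∂ξ_μ` commutes with the first summand
and has commutator `δ_{μν}` with the second. -/
theorem symbolDeriv_nabla (μ ν : ι) (C : (ι → ℕ) →₀ A) :
    symbolDeriv μ (nabla D ν C) = nabla D ν (symbolDeriv μ C) + if ν = μ then C else 0 := by
  induction C using Finsupp.induction_linear with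
  | zero => simp
  | add C C' h h' => simp only [map_add, h, h']; split_ifs <;> abel
  | single β a =>
    simp only [nabla_single, symbolDeriv_single, map_add, map_smul, smul_add, add_assoc]
    congr 1
    rcases eq_or_ne ν μ with rfl | hνμ
    · rcases eq_or_ne (β ν) 0 with h | h
      · simp [h]
      · simp [sub_single_add_single h, add_smul]
    · rcases eq_or_ne (β μ) 0 with h | h
      · simp [h, hνμ, hνμ.symm]
      · have : β + Pi.single ν 1 - Pi.single μ 1 = β - Pi.single μ 1 + Pi.single ν 1 := by
          conv_lhs => rw [← sub_single_add_single h]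
          rw [add_right_comm, add_tsub_cancel_right]
        simp [hνμ, hνμ.symm, this]

variable [Fintype ι]

/-- The homotopy from which divergence-free operators are seen to be curls. -/
theorem sum_nabla_symbolCurl (C : ι → (ι → ℕ) →₀ A) (hC : ∑ ν, nabla D ν (C ν) = 0) (μ : ι) :
    ∑ ν, nabla D ν (symbolDeriv ν (C μ) - symbolDeriv μ (C ν)) =
      ∑ ν, nabla D ν (symbolDeriv ν (C μ)) + C μ := by
  have h : ∑ ν, (nabla D ν (symbolDeriv μ (C ν)) + if ν = μ then C ν else 0) = 0 := by
    simp_rw [← symbolDeriv_nabla, ← map_sum, hC, map_zero]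
  rw [Finset.sum_add_distrib, Finset.sum_ite_eq' _ _ C, if_pos (Finset.mem_univ μ)] at h
  simp only [map_sub, Finset.sum_sub_distrib, eq_neg_of_add_eq_zero_left h, sub_neg_eq_add]

/-- To leading order `∑ ∇_ν ∂/∂ξ_ν` is the Euler field `∑ ξ_ν ∂/∂ξ_ν`, which multiplies terms of
order `k` by `k`; the corrections, where `D ν` hits a coefficient, have lower order. -/
theorem smul_sub_sum_nabla_symbolDeriv_mem (k : ℕ) {C : (ι → ℕ) →₀ A}
    (hC : C ∈ Finsupp.supported A ℝ {β : ι → ℕ | ∑ μ, β μ < k + 1}) :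
    (k : ℝ) • C - ∑ ν, nabla D ν (symbolDeriv ν C) ∈
      Finsupp.supported A ℝ {β : ι → ℕ | ∑ μ, β μ < k} := by
  let L : ((ι → ℕ) →₀ A) →ₗ[ℝ] ((ι → ℕ) →₀ A) :=
    (k : ℝ) • LinearMap.id - ∑ ν, nabla D ν ∘ₗ symbolDeriv ν
  have hL : (k : ℝ) • C - ∑ ν, nabla D ν (symbolDeriv ν C) = L C := by simp [L]
  rw [hL, ← C.sum_single, map_finsuppSum]
  refine Submodule.sum_mem _ fun β hβ => ?_
  have hβ' : ∑ μ, β μ < k + 1 := hC hβ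
  have h1 : ∀ ν, nabla D ν (symbolDeriv ν (Finsupp.single β (C β))) =
      (β ν : ℝ) • Finsupp.single (β - Pi.single ν 1) (D ν (C β)) +
        (β ν : ℝ) • Finsupp.single β (C β) := by
    intro ν
    rcases eq_or_ne (β ν) 0 with h | h
    · simp [h]
    · simp only [symbolDeriv_single, map_smul, nabla_single, sub_single_add_single h, smul_add]
  have h2 : L (Finsupp.single β (C β)) =
      ((k : ℝ) - ∑ ν, (β ν : ℝ)) • Finsupp.single β (C β) -
        ∑ ν, (β ν : ℝ) • Finsupp.single (β - Pi.single ν 1) (D ν (C β)) := by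
    simp only [L, LinearMap.sub_apply, LinearMap.smul_apply, LinearMap.id_apply,
      LinearMap.sum_apply, LinearMap.comp_apply, h1, Finset.sum_add_distrib, ← Finset.sum_smul,
      sub_smul]
    abel
  change L (Finsupp.single β (C β)) ∈ _
  rw [h2]
  refine Submodule.sub_mem _ ?_ (Submodule.sum_mem _ fun ν _ => ?_)
  · rcases (Nat.lt_succ_iff.1 hβ').lt_or_eq with h | h
    · exact Submodule.smul_mem _ _ (Finsupp.single_mem_supported ℝ _ h)
    · simp [← h]
  · rcases eq_or_ne (β ν) 0 with h | h
    · simp [h]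
    · refine Submodule.smul_mem _ _ (Finsupp.single_mem_supported ℝ _ ?_)
      have h3 : ∑ κ, β κ = ∑ κ, (β - Pi.single ν 1 : ι → ℕ) κ + 1 := by
        conv_lhs => rw [← sub_single_add_single h]
        simp [Finset.sum_add_distrib]
      simp only [Set.mem_ofPred_eq]
      omega

/-- A divergence-free linear current is a curl. -/
theorem exists_symbolCurl (hD : ∀ μ ν a, D μ (D ν a) = D ν (D μ a))
    (C : ι → (ι → ℕ) →₀ A) (hC : ∑ μ, nabla D μ (C μ) = 0) :
    ∃ M : ι → ι → (ι → ℕ) →₀ A, (∀ μ ν, M μ ν = -M ν μ) ∧ ∀ μ, C μ = ∑ ν, nabla D ν (M μ ν) := by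
  suffices H : ∀ (k : ℕ) (C : ι → (ι → ℕ) →₀ A),
      (∀ μ, C μ ∈ Finsupp.supported A ℝ {β : ι → ℕ | ∑ μ, β μ < k}) →
      ∑ μ, nabla D μ (C μ) = 0 →
      ∃ M : ι → ι → (ι → ℕ) →₀ A,
        (∀ μ ν, M μ ν = -M ν μ) ∧ ∀ μ, C μ = ∑ ν, nabla D ν (M μ ν) by
    refine H ((Finset.univ.sup fun μ => (C μ).support.sup fun β => ∑ κ, β κ) + 1) C
      (fun μ β hβ => Nat.lt_succ_iff.2 ?_) hC
    exact (Finset.le_sup (f := fun β : ι → ℕ => ∑ κ, β κ) hβ).trans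
      (Finset.le_sup (f := fun μ => (C μ).support.sup fun β => ∑ κ, β κ) (Finset.mem_univ μ))
  intro k
  induction k with
  | zero =>
    intro C hk _
    refine ⟨fun _ _ => 0, by simp, fun μ => ?_⟩
    simpa [Finsupp.supported_empty] using hk μ
  | succ k ih =>
    intro C hk hC
    -- For order at most `k`, the divergence of the symbol curl is `(k + 1) C μ` up to lower order:
    -- `k` from the Euler field and `1` from the commutator. Subtracting `c` times it lowers the
    -- order.
    set c : ℝ := ((k : ℝ) + 1)⁻¹ with hc
    have hc' : c * ((k : ℝ) + 1) = 1 := inv_mul_cancel₀ (by positivity)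
    set H : ι → ι → (ι → ℕ) →₀ A := fun μ ν =>
      c • (symbolDeriv ν (C μ) - symbolDeriv μ (C ν)) with hH
    have hHanti : ∀ μ ν, H μ ν = -H ν μ := fun μ ν => by simp [hH, ← smul_neg]
    have hdiff : ∀ μ, C μ - ∑ ν, nabla D ν (H μ ν) =
        c • ((k : ℝ) • C μ - ∑ ν, nabla D ν (symbolDeriv ν (C μ))) := by
      intro μ
      simp only [hH, map_smul, ← Finset.smul_sum, sum_nabla_symbolCurl D C hC μ]
      nth_rw 1 [← one_smul ℝ (C μ)]
      rw [← hc']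
      module
    obtain ⟨M, hM, hCM⟩ := ih (fun μ => C μ - ∑ ν, nabla D ν (H μ ν))
      (fun μ => by
        rw [hdiff]
        exact Submodule.smul_mem _ _ (smul_sub_sum_nabla_symbolDeriv_mem D k (hk μ)))
      (by
        simp only [map_sub, map_sum, Finset.sum_sub_distrib, hC, zero_sub, neg_eq_zero]
        exact sum_sum_eq_zero_of_antisymm _ fun μ ν => by
          rw [nabla_comm D hD, hHanti μ ν, map_neg, map_neg])
    refine ⟨fun μ ν => M μ ν + H μ ν, fun μ ν => ?_, fun μ => ?_⟩
    · change M μ ν + H μ ν = -(M ν μ + H ν μ)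
      rw [hM μ ν, hHanti μ ν]
      abel
    · simp only [map_add, Finset.sum_add_distrib, ← hCM]
      abel

end LinearCurrents

/-! ### Linearization of differential functions -/

section Nabla

variable {ι A : Type*} [DecidableEq ι] [AddCommGroup A] [Module ℝ A] (D : ι → A →ₗ[ℝ] A)

theorem nabla_apply_add_single (μ : ι) (γ : ι → ℕ) (C : (ι → ℕ) →₀ A) :
    nabla D μ C (γ + Pi.single μ 1) = D μ (C (γ + Pi.single μ 1)) + C γ := by
  simp only [nabla, LinearMap.add_apply, Finsupp.add_apply, Finsupp.mapRange.linearMap_apply,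
    Finsupp.mapRange_apply, Finsupp.lmapDomain_apply]
  rw [Finsupp.mapDomain_apply (add_left_injective (Pi.single μ 1)) C γ]

theorem nabla_apply_of_eq_zero {μ : ι} {γ : ι → ℕ} (h : γ μ = 0) (C : (ι → ℕ) →₀ A) :
    nabla D μ C γ = D μ (C γ) := by
  simp only [nabla, LinearMap.add_apply, Finsupp.add_apply, Finsupp.mapRange.linearMap_apply,
    Finsupp.mapRange_apply, Finsupp.lmapDomain_apply]
  rw [Finsupp.mapDomain_of_notMem_range, add_zero]
  rintro ⟨β, rfl⟩
  simp at h

end Nabla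

variable (n) in
/-- The total derivatives as linear maps. -/
noncomputable def totL (μ : Option (Fin n)) : DF n →ₗ[ℝ] DF n := (totD μ).toLinearMap

@[simp] theorem totL_apply (μ : Option (Fin n)) (F : DF n) : totL n μ F = totD μ F := rfl

theorem finite_support_pdD_uvar (F : DF n) :
    (Function.support fun β : MIdx n => pdD (uvar β) F).Finite := by
  obtain ⟨S, hS⟩ := F.exists_support
  refine (S.preimage uvar uvar_injective.injOn).finite_toSet.subset fun β hβ => ?_
  by_contra h
  exact hβ (pdD_eq_zero hS (by simpa using h))

/-- The Fréchet derivative of a differential function. -/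
noncomputable def frechet : DF n →ₗ[ℝ] (MIdx n →₀ DF n) where
  toFun F := Finsupp.ofSupportFinite _ (finite_support_pdD_uvar F)
  map_add' F G := by ext1 β; exact map_add (pdD (uvar β)) F G
  map_smul' c F := by ext1 β; exact (pdD (uvar β)).map_smul c F

@[simp] theorem frechet_apply (F : DF n) (β : MIdx n) : frechet F β = pdD (uvar β) F := rfl

/-- Linearization turns total differentiation of functions into composition of operators, so a
divergence-free current has a divergence-free linearization. -/
theorem frechet_totD (μ : Option (Fin n)) (F : DF n) :
    frechet (totD μ F) = nabla (totL n) μ (frechet F) := by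
  ext1 γ
  rcases eq_or_ne (γ μ) 0 with h | h
  · rw [nabla_apply_of_eq_zero _ h]
    exact pdD_uvar_totD_of_eq_zero h F
  · rw [← sub_single_add_single h, nabla_apply_add_single]
    exact pdD_uvar_add_single_totD μ _ F

/-! ### Averaging over dilations of some of the jet coordinates -/

theorem DF.contDiff_comp {E : Type*} [NormedAddCommGroup E] [NormedSpace ℝ E] (F : DF n)
    {γ : E → Jet n} (hγ : ∀ v, ContDiff ℝ ∞ fun p => γ p v) :
    ContDiff ℝ ∞ fun p => (F : Jet n → ℝ) (γ p) := by
  obtain ⟨S, f, hf, hF⟩ := F.exists_support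
  simp only [hF]
  exact hf.comp (contDiff_pi.2 fun v => hγ v)

open Classical in
/-- Multiplication by `s` of the coordinates in `K`. -/
noncomputable def dilate (K : Set (JetVar n)) (s : ℝ) (z : Jet n) : Jet n :=
  fun v => (if v ∈ K then s else 1) * z v

theorem contDiff_dilate (K : Set (JetVar n)) {E : Type*} [NormedAddCommGroup E] [NormedSpace ℝ E]
    {γ : E → Jet n} (hγ : ∀ v, ContDiff ℝ ∞ fun p => γ p v) {σ : E → ℝ} (hσ : ContDiff ℝ ∞ σ)
    (v : JetVar n) : ContDiff ℝ ∞ fun p => dilate K (σ p) (γ p) v := by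
  by_cases hv : v ∈ K
  · simpa [dilate, hv] using hσ.mul (hγ v)
  · simpa [dilate, hv] using hγ v

theorem DF.contDiff_dilate (F : DF n) (K : Set (JetVar n)) (z : Jet n) :
    ContDiff ℝ ∞ fun s => (F : Jet n → ℝ) (dilate K s z) :=
  F.contDiff_comp
    (ConsLaw.contDiff_dilate K (γ := fun _ => z) (fun _ => contDiff_const) contDiff_id)

theorem dilationIntegrand_integrable (K : Set (JetVar n)) (k : ℕ) (F : DF n) (z : Jet n) :
    IntervalIntegrable (fun s => s ^ k * (F : Jet n → ℝ) (dilate K s z)) MeasureTheory.volume 0 1 :=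
  ((continuous_pow k).mul (F.contDiff_dilate K z).continuous).intervalIntegrable _ _

theorem IsSmoothIn.dilationIntegral {S : Finset (JetVar n)} {F : Jet n → ℝ} (hF : IsSmoothIn S F)
    (K : Set (JetVar n)) (k : ℕ) :
    IsSmoothIn S fun z => ∫ s in (0 : ℝ)..1, s ^ k * F (dilate K s z) := by
  classical
  obtain ⟨f, hf, hF⟩ := hF
  refine ⟨fun y => ∫ s in (0 : ℝ)..1,
      s ^ k * f fun v => (if (v : JetVar n) ∈ K then s else 1) * y v,
    contDiff_parametric_integral
      (h := fun p : (S → ℝ) × ℝ => p.2 ^ k * f fun v =>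
        (if (v : JetVar n) ∈ K then p.2 else 1) * p.1 v)
      ((contDiff_snd.pow k).mul (hf.comp (contDiff_pi.2 fun v => ?_))), fun z => ?_⟩
  · refine ContDiff.mul ?_ ((contDiff_apply ℝ ℝ v).comp contDiff_fst)
    split_ifs
    · exact contDiff_snd
    · exact contDiff_const
  · simp only [hF]
    rfl

/-- The average `F ↦ ∫₀¹ s^k F(s·z) ds`, where `s·z` is the dilation of the coordinates in `K`. -/
noncomputable def dilationIntegral (K : Set (JetVar n)) (k : ℕ) : DF n →ₗ[ℝ] DF n where
  toFun F := ⟨fun z => ∫ s in (0 : ℝ)..1, s ^ k * (F : Jet n → ℝ) (dilate K s z), by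
    obtain ⟨S, hS⟩ := F.exists_support
    exact ⟨S, Set.subset_univ _, hS.dilationIntegral K k⟩⟩
  map_add' F G := Subtype.ext <| funext fun z => by
    simp only [AddMemClass.coe_add, Pi.add_apply, mul_add]
    exact intervalIntegral.integral_add (dilationIntegrand_integrable K k F z)
      (dilationIntegrand_integrable K k G z)
  map_smul' c F := Subtype.ext <| funext fun z => by
    simp only [SetLike.val_smul, Pi.smul_apply, smul_eq_mul, mul_left_comm _ c, RingHom.id_apply]
    exact intervalIntegral.integral_const_mul c _

theorem dilationIntegral_apply (K : Set (JetVar n)) (k : ℕ) (F : DF n) (z : Jet n) :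
    (dilationIntegral K k F : Jet n → ℝ) z =
      ∫ s in (0 : ℝ)..1, s ^ k * (F : Jet n → ℝ) (dilate K s z) := rfl

theorem coord_mul_dilationIntegral_of_mem {K : Set (JetVar n)} {v : JetVar n} (hv : v ∈ K) (k : ℕ)
    (F : DF n) :
    dilationIntegral K k (coordD v * F) = coordD v * dilationIntegral K (k + 1) F := by
  refine Subtype.ext (funext fun z => ?_)
  simp only [MulMemClass.coe_mul, Pi.mul_apply, dilationIntegral_apply, coordD_apply,
    ← intervalIntegral.integral_const_mul]
  refine intervalIntegral.integral_congr fun s _ => ?_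
  simp only [dilate, hv, if_true]
  ring

theorem hasDerivAt_dilate_update (K : Set (JetVar n)) (s : ℝ) (F : DF n) (v : JetVar n)
    (z : Jet n) :
    HasDerivAt (fun y => (F : Jet n → ℝ) (dilate K s (Function.update z v y)))
      (dilate K s 1 v * pd v F (dilate K s z)) (z v) := by
  classical
  obtain ⟨S, hS⟩ := F.exists_support
  have h := (hS.mono (Finset.subset_insert v S)).hasDerivAt_curve
    (γ := fun y => dilate K s (Function.update z v y))
    (w := dilate K s (Pi.single v 1)) (s₀ := z v)
    fun w _ => (IsSmoothIn.hasDerivAt_update_coord z v w).const_mul _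
  rw [Finset.sum_eq_single v] at h
  · simpa [dilate] using h
  · intro w _ hw
    simp [dilate, hw]
  · simp

theorem pd_dilationIntegral (K : Set (JetVar n)) (k : ℕ) (F : DF n) (v : JetVar n) (z : Jet n) :
    pd v (dilationIntegral K k F) z =
      ∫ s in (0 : ℝ)..1, s ^ k * (dilate K s 1 v * pd v F (dilate K s z)) := by
  set G : ℝ × ℝ → ℝ := fun p =>
    p.2 ^ k * (F : Jet n → ℝ) (dilate K p.2 (Function.update z v p.1)) with hG
  have hGs : ContDiff ℝ ∞ G := by
    refine (contDiff_snd.pow k).mul (F.contDiff_comp (contDiff_dilate K (fun w => ?_) contDiff_snd))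
    by_cases hw : w = v
    · subst hw; simpa using contDiff_fst
    · simpa [hw] using contDiff_const
  have h1 := (hasFDerivAt_parametric_integral
    (hGs.of_le (by exact_mod_cast le_top)) (z v)).hasDerivAt
  refine h1.deriv.trans ?_
  rw [ContinuousLinearMap.intervalIntegral_apply
    ((((hGs.continuous_fderiv (by simp)).comp (by fun_prop)).clm_comp
      continuous_const).intervalIntegrable _ _)]
  refine intervalIntegral.integral_congr fun s _ => ?_
  have h2 := ((hGs.differentiable (by simp) (z v, s)).hasFDerivAt.comp (z v)
    (hasFDerivAt_prodMk_left (𝕜 := ℝ) (z v) s)).hasDerivAt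
  exact h2.unique ((hasDerivAt_dilate_update K s F v z).const_mul (s ^ k))

/-- The chain rule contributes one factor `s`, which raises the weight. -/
theorem pdD_dilationIntegral_of_mem {K : Set (JetVar n)} {v : JetVar n} (hv : v ∈ K) (k : ℕ)
    (F : DF n) :
    pdD v (dilationIntegral K k F) = dilationIntegral K (k + 1) (pdD v F) := by
  refine Subtype.ext (funext fun z => ?_)
  simp [pd_dilationIntegral, dilationIntegral_apply, dilate, hv, pow_succ, mul_assoc]

theorem pdD_dilationIntegral_of_notMem {K : Set (JetVar n)} {v : JetVar n} (hv : v ∉ K) (k : ℕ)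
    (F : DF n) :
    pdD v (dilationIntegral K k F) = dilationIntegral K k (pdD v F) := by
  refine Subtype.ext (funext fun z => ?_)
  simp [pd_dilationIntegral, dilationIntegral_apply, dilate, hv]

open Classical in
-- The fundamental theorem of calculus for `s ↦ s^k F(s·z)` on `[0, 1]`. The boundary term at `0`
-- survives only for `k = 0`, and there the truncated exponent `k - 1` is harmless because its term
-- carries the factor `k`.
theorem integral_deriv_dilation (K : Set (JetVar n)) (k : ℕ) (F : DF n) {S : Finset (JetVar n)}
    (hS : IsSmoothIn S (F : Jet n → ℝ)) (z : Jet n) :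
    (F : Jet n → ℝ) z - 0 ^ k * (F : Jet n → ℝ) (dilate K 0 z) =
      k * (dilationIntegral K (k - 1) F : Jet n → ℝ) z +
        ∑ v ∈ S, if v ∈ K then z v * (dilationIntegral K k (pdD v F) : Jet n → ℝ) z else 0 := by
  have hd : ∀ s : ℝ, HasDerivAt (fun s => s ^ k * (F : Jet n → ℝ) (dilate K s z))
      (k * (s ^ (k - 1) * (F : Jet n → ℝ) (dilate K s z)) +
        ∑ v ∈ S, (if v ∈ K then z v else 0) *
          (s ^ k * (pdD v F : Jet n → ℝ) (dilate K s z))) s := by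
    intro s
    have h := hS.hasDerivAt_curve (γ := fun s => dilate K s z)
      (w := fun v => if v ∈ K then z v else 0) (s₀ := s) (fun v _ => by
        by_cases hv : v ∈ K
        · simpa [dilate, hv] using (hasDerivAt_id s).mul_const (z v)
        · simpa [dilate, hv] using hasDerivAt_const s (z v))
    refine ((hasDerivAt_pow k s).mul h).congr_deriv ?_
    rw [Finset.mul_sum]
    congr 1
    · ring
    · exact Finset.sum_congr rfl fun v _ => by rw [coe_pdD]; ring
  have hi : ∀ v ∈ S, IntervalIntegrable (fun s => (if v ∈ K then z v else 0) *
      (s ^ k * (pdD v F : Jet n → ℝ) (dilate K s z))) MeasureTheory.volume 0 1 :=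
    fun v _ => (dilationIntegrand_integrable K k (pdD v F) z).const_mul _
  have hi0 := (dilationIntegrand_integrable K (k - 1) F z).const_mul (k : ℝ)
  have hsum := IntervalIntegrable.sum S hi
  rw [Finset.sum_fn] at hsum
  have h := intervalIntegral.integral_eq_sub_of_hasDerivAt (a := 0) (b := 1) (fun s _ => hd s)
    (hi0.add hsum)
  rw [intervalIntegral.integral_add hi0 hsum,
    intervalIntegral.integral_finsetSum hi, intervalIntegral.integral_const_mul] at h
  have h1 : dilate K 1 z = z := by funext v; simp [dilate]
  rw [h1, one_pow, one_mul] at h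
  rw [← h]
  congr 1
  refine Finset.sum_congr rfl fun v _ => ?_
  rw [intervalIntegral.integral_const_mul, dilationIntegral_apply]
  split_ifs <;> simp

/-! ### Divergence-free currents are curls -/

/-- Averaging over dilations of `u`, after substitution of `u` for the indeterminate of a
differential operator. -/
noncomputable def evalAverage : (MIdx n →₀ DF n) →ₗ[ℝ] DF n :=
  Finsupp.lsum ℝ fun β =>
    LinearMap.mulLeft ℝ (coordD (uvar β)) ∘ₗ dilationIntegral (Set.range uvar) 0

@[simp] theorem evalAverage_single (β : MIdx n) (F : DF n) :
    evalAverage (Finsupp.single β F) =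
      coordD (uvar β) * dilationIntegral (Set.range uvar) 0 F := by
  simp [evalAverage]

/-- Total derivatives commute with scaling of `u`: the factor `s` from `∂/∂u_β` is the one needed to
scale the component `u_{β+μ}` of `D_μ`. -/
theorem totD_dilationIntegral (μ : Option (Fin n)) (F : DF n) :
    totD μ (dilationIntegral (Set.range uvar) 0 F) =
      dilationIntegral (Set.range uvar) 0 (totD μ F) := by
  obtain ⟨S, hS⟩ := F.exists_support
  rw [totD_eq_sum μ hS, totD_eq_sum μ (F := dilationIntegral _ 0 F) (hS.dilationIntegral _ 0),
    map_sum]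
  refine Finset.sum_congr rfl fun v _ => ?_
  induction v using JetVar.bvar_uvar_cases with
  | base κ =>
    rw [pdD_dilationIntegral_of_notMem (by simp), totCoord_bvar]
    split_ifs <;> simp
  | jet β =>
    rw [pdD_dilationIntegral_of_mem (Set.mem_range_self β), totCoord_uvar,
      coord_mul_dilationIntegral_of_mem (Set.mem_range_self _)]

/-- The two terms of `nabla` match the two terms of the Leibniz rule for `u_β` times an averaged
coefficient. -/
theorem evalAverage_nabla (μ : Option (Fin n)) (C : MIdx n →₀ DF n) :
    evalAverage (nabla (totL n) μ C) = totD μ (evalAverage C) := by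
  induction C using Finsupp.induction_linear with
  | zero => simp
  | add C C' h h' => simp only [map_add, h, h']
  | single β F =>
    simp [totD_coordD, totD_dilationIntegral, add_comm, mul_comm]

/-- The part of a differential function that depends on `u` is the average of its Fréchet
derivative along `u`. -/
theorem sub_evalAverage_frechet (F : DF n) (z : Jet n) :
    ((F - evalAverage (frechet F) : DF n) : Jet n → ℝ) z =
      (F : Jet n → ℝ) (dilate (Set.range uvar) 0 z) := by
  classical
  obtain ⟨S, hS⟩ := F.exists_support
  have h := integral_deriv_dilation (Set.range uvar) 0 F hS z
  have h1 : evalAverage (frechet F) = ∑ β ∈ S.preimage uvar uvar_injective.injOn,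
      coordD (uvar β) * dilationIntegral (Set.range uvar) 0 (pdD (uvar β) F) := by
    rw [evalAverage, Finsupp.lsum_apply, Finsupp.sum_of_support_subset (s := S.preimage uvar
      uvar_injective.injOn) _ (fun β hβ => ?_) _ (by simp)]
    · rfl
    · by_contra hh
      exact (Finsupp.mem_support_iff.1 hβ) (pdD_eq_zero hS (by simpa using hh))
  have h2 : (evalAverage (frechet F) : Jet n → ℝ) z = ∑ v ∈ S, if v ∈ Set.range uvar then
      z v * (dilationIntegral (Set.range uvar) 0 (pdD v F) : Jet n → ℝ) z else 0 := by
    rw [h1, ← Finset.sum_preimage uvar S uvar_injective.injOn _ fun v _ hv => if_neg hv]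
    simp [Finset.sum_apply]
  rw [pow_zero, one_mul, Nat.cast_zero, zero_mul, zero_add, ← h2] at h
  simp only [AddSubgroupClass.coe_sub, Pi.sub_apply]
  linarith

theorem pdD_uvar_sub_evalAverage_frechet (F : DF n) (β : MIdx n) :
    pdD (uvar β) (F - evalAverage (frechet F)) = 0 := by
  refine Subtype.ext (funext fun z => ?_)
  rw [coe_pdD, pd]
  simp only [sub_evalAverage_frechet]
  have : ∀ s, dilate (Set.range uvar) 0 (Function.update z (uvar β) s) =
      dilate (Set.range uvar) 0 z := by
    intro s
    funext v
    by_cases hv : v ∈ Set.range uvar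
    · simp [dilate, hv]
    · have : v ≠ uvar β := by rintro rfl; exact hv ⟨β, rfl⟩
      simp [dilate, this]
  simp [this]

theorem totD_of_pdD_uvar_eq_zero {F : DF n} (hF : ∀ β, pdD (uvar β) F = 0) (μ : Option (Fin n)) :
    totD μ F = pdD (bvar μ) F := by
  classical
  obtain ⟨S, hS⟩ := F.exists_support
  rw [totD_eq_sum μ (hS.mono (Finset.subset_insert (bvar μ) S)), Finset.sum_eq_single (bvar μ)]
  · simp
  · intro v _ hv
    induction v using JetVar.bvar_uvar_cases with
    | base κ =>
      have : μ ≠ κ := by rintro rfl; exact hv rfl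
      simp [this]
    | jet β => simp [hF]
  · simp

theorem eq_smul_dilationIntegral_bvar {F : DF n} {k : ℕ} (hk : k ≠ 0) :
    F = (k : ℝ) • dilationIntegral (Set.range bvar) (k - 1) F +
      ∑ ν, coordD (bvar ν) * dilationIntegral (Set.range bvar) k (pdD (bvar ν) F) := by
  classical
  obtain ⟨S, hS⟩ := F.exists_support
  refine Subtype.ext (funext fun z => ?_)
  have h := integral_deriv_dilation (Set.range bvar) k F hS z
  rw [zero_pow hk, zero_mul, sub_zero] at h
  rw [h]
  simp only [AddMemClass.coe_add, Pi.add_apply, SetLike.val_smul, Pi.smul_apply, smul_eq_mul,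
    AddSubmonoidClass.coe_finsetSum, Finset.sum_apply, MulMemClass.coe_mul, Pi.mul_apply,
    coordD_apply]
  congr 1
  refine (Finset.sum_preimage bvar S bvar_injective.injOn _ fun v _ hv => if_neg hv).symm.trans ?_
  simp only [Set.mem_range_self, if_true]
  refine Finset.sum_subset (Finset.subset_univ _) fun ν _ hν => ?_
  rw [pdD_eq_zero hS (by simpa using hν)]
  simp

/-- The Poincaré lemma for currents on the space of independent variables. -/
theorem exists_curl_of_pdD_uvar_eq_zero (hn : n ≠ 0) (B : Option (Fin n) → DF n)
    (hB : ∀ μ β, pdD (uvar β) (B μ) = 0) (hdiv : ∑ μ, totD μ (B μ) = 0) :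
    ∃ ψ : Option (Fin n) → Option (Fin n) → DF n,
      (∀ μ ν, ψ μ ν = -ψ ν μ) ∧ ∀ μ, B μ = ∑ ν, totD ν (ψ μ ν) := by
  set J : ℕ → DF n →ₗ[ℝ] DF n := dilationIntegral (Set.range bvar) with hJ
  have hJu : ∀ k μ β, pdD (uvar β) (J k (B μ)) = 0 := fun k μ β => by
    rw [hJ, pdD_dilationIntegral_of_notMem (by simp), hB, map_zero]
  have hDJ : ∀ k μ ν, totD ν (J k (B μ)) = J (k + 1) (pdD (bvar ν) (B μ)) := fun k μ ν => by
    rw [totD_of_pdD_uvar_eq_zero (hJu k μ), hJ, pdD_dilationIntegral_of_mem (Set.mem_range_self ν)]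
  have hdiv' : ∑ ν, J n (pdD (bvar ν) (B ν)) = 0 := by
    simp_rw [← totD_of_pdD_uvar_eq_zero (hB _), ← map_sum, hdiv, map_zero]
  -- The radial homotopy in `n + 1` variables. In the divergence, `J (n - 1) (B μ)` occurs `n + 1`
  -- times from `∂_ν y^ν` and once with a minus sign; the resulting factor `n` is the one produced
  -- by integrating the derivative of `s^n B_μ(s y)`.
  refine ⟨fun μ ν => coordD (bvar ν) * J (n - 1) (B μ) - coordD (bvar μ) * J (n - 1) (B ν),
    fun μ ν => by ring, fun μ => ?_⟩
  have h1 : ∀ ν, totD ν (coordD (bvar ν) * J (n - 1) (B μ) - coordD (bvar μ) * J (n - 1) (B ν)) =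
      coordD (bvar ν) * J n (pdD (bvar ν) (B μ)) + J (n - 1) (B μ)
        - coordD (bvar μ) * J n (pdD (bvar ν) (B ν)) -
          (if ν = μ then J (n - 1) (B ν) else 0) := by
    intro ν
    simp only [map_sub, Derivation.leibniz, hDJ, Nat.sub_add_cancel (Nat.one_le_iff_ne_zero.2 hn),
      totD_coordD, totCoord_bvar, if_true, smul_eq_mul, mul_one, mul_ite, mul_zero]
    abel
  simp only [h1, Finset.sum_sub_distrib, Finset.sum_add_distrib, ← Finset.mul_sum, hdiv',
    Finset.sum_const, Finset.card_univ, Fintype.card_option, Fintype.card_fin, mul_zero, sub_zero,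
    Finset.sum_ite_eq', Finset.mem_univ, if_true]
  conv_lhs => rw [eq_smul_dilationIntegral_bvar (F := B μ) hn]
  rw [Nat.cast_smul_eq_nsmul, succ_nsmul]
  abel

/-- A current whose total divergence vanishes identically on the jet space is a total curl. -/
theorem exists_curl (hn : n ≠ 0) (A : Option (Fin n) → DF n) (hdiv : ∑ μ, totD μ (A μ) = 0) :
    ∃ ψ : Option (Fin n) → Option (Fin n) → DF n,
      (∀ μ ν, ψ μ ν = -ψ ν μ) ∧ ∀ μ, A μ = ∑ ν, totD ν (ψ μ ν) := by
  obtain ⟨M, hM, hAM⟩ := exists_symbolCurl (totL n) totD_comm (fun μ => frechet (A μ)) (by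
    simp_rw [← frechet_totD, ← map_sum, hdiv, map_zero])
  -- What remains after removing the averaged linearization is the current at `u = 0`, still
  -- divergence-free.
  obtain ⟨ψ, hψ, hBψ⟩ := exists_curl_of_pdD_uvar_eq_zero hn
    (fun μ => A μ - evalAverage (frechet (A μ)))
    (fun μ => pdD_uvar_sub_evalAverage_frechet (A μ)) (by
      simp_rw [map_sub, Finset.sum_sub_distrib, hdiv, ← evalAverage_nabla, ← frechet_totD,
        ← map_sum, hdiv, map_zero, sub_zero])
  refine ⟨fun μ ν => ψ μ ν + evalAverage (M μ ν), fun μ ν => ?_, fun μ => ?_⟩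
  · change ψ μ ν + evalAverage (M μ ν) = -(ψ ν μ + evalAverage (M ν μ))
    rw [hψ μ ν, hM μ ν, neg_add]
    exact congrArg _ (map_neg evalAverage (M ν μ))
  · simp_rw [map_add, Finset.sum_add_distrib, ← hBψ, ← evalAverage_nabla, ← map_sum, ← hAM]
    abel

/-! ### Iterated total derivatives -/

@[elab_as_elim]
theorem multiIndex_induction {ι : Type*} [Fintype ι] [DecidableEq ι] {P : (ι → ℕ) → Prop}
    (β : ι → ℕ) (zero : P 0) (add_single : ∀ β μ, P β → P (β + Pi.single μ 1)) : P β := by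
  induction h : ∑ μ, β μ generalizing β with
  | zero =>
    have : β = 0 := funext fun μ => (Finset.sum_eq_zero_iff.1 h) μ (Finset.mem_univ μ)
    rwa [this]
  | succ k ih =>
    obtain ⟨μ, hμ⟩ : ∃ μ, β μ ≠ 0 := by
      by_contra! hh
      simp [hh] at h
    rw [← sub_single_add_single hμ]
    refine add_single _ μ (ih _ ?_)
    rw [← sub_single_add_single hμ] at h
    simpa [Finset.sum_add_distrib] using h

theorem totL_commute (μ ν : Option (Fin n)) : Commute (totL n μ) (totL n ν) :=
  LinearMap.ext fun F => totD_comm μ ν F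

theorem coe_totL_pow (μ : Option (Fin n)) (k : ℕ) (F : DF n) :
    (((totL n μ ^ k) F : DF n) : Jet n → ℝ) = (tot μ)^[k] F := by
  induction k with
  | zero => rfl
  | succ k ih => rw [pow_succ', Function.iterate_succ_apply', ← ih]; rfl

/-- `D_x^α` as a linear map. -/
noncomputable def DxPowL (α : Fin n → ℕ) : Module.End ℝ (DF n) :=
  ((List.finRange n).map fun i => totL n (some i) ^ α i).prod

theorem coe_DxPowL (α : Fin n → ℕ) (F : DF n) :
    (DxPowL α F : Jet n → ℝ) = DxPow α (F : Jet n → ℝ) := by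
  unfold DxPowL DxPow
  induction List.finRange n with
  | nil => rfl
  | cons i l ih =>
    rw [List.map_cons, List.prod_cons, List.foldr_cons, ← ih]
    exact coe_totL_pow (some i) (α i) _

theorem commute_totL_DxPowL (μ : Option (Fin n)) (α : Fin n → ℕ) :
    Commute (totL n μ) (DxPowL α) :=
  Commute.list_prod_right _ _ fun f hf => by
    obtain ⟨i, -, rfl⟩ := List.mem_map.1 hf
    exact (totL_commute μ (some i)).pow_right _

theorem DxPowL_zero : DxPowL (0 : Fin n → ℕ) = 1 := by
  simp [DxPowL]

theorem DxPowL_add_single (α : Fin n → ℕ) (i : Fin n) :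
    DxPowL (α + Pi.single i 1) = totL n (some i) * DxPowL α := by
  have key : ∀ l : List (Fin n), l.Nodup →
      (l.map fun j => totL n (some j) ^ (α + Pi.single i 1 : Fin n → ℕ) j).prod =
        (if i ∈ l then totL n (some i) else 1) * (l.map fun j => totL n (some j) ^ α j).prod := by
    intro l hl
    induction l with
    | nil => simp
    | cons j l ih =>
      obtain ⟨hj, hl⟩ := List.nodup_cons.1 hl
      rw [List.map_cons, List.prod_cons, ih hl, List.map_cons, List.prod_cons]
      rcases eq_or_ne i j with rfl | hij
      · simp [hj, pow_succ', mul_assoc]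
      · have h1 : (α + Pi.single i 1 : Fin n → ℕ) j = α j := by simp [hij.symm]
        rw [h1, ← mul_assoc, ← mul_assoc]
        congr 1
        simp only [List.mem_cons, hij, false_or]
        split_ifs
        · exact ((totL_commute (some i) (some j)).pow_right _).symm.eq
        · simp
  simpa [DxPowL] using key (List.finRange n) (List.nodup_finRange n)

/-- `D_t^j D_x^α` as a linear map. -/
noncomputable def totPow (β : MIdx n) : Module.End ℝ (DF n) :=
  totL n none ^ β none * DxPowL fun i => β (some i)

theorem totPow_zero : totPow (0 : MIdx n) = 1 := by
  have h : DxPowL (fun i : Fin n => (0 : MIdx n) (some i)) = 1 := DxPowL_zero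
  rw [totPow, h, Pi.zero_apply, pow_zero, one_mul]

theorem totPow_add_single (β : MIdx n) (μ : Option (Fin n)) :
    totPow (β + Pi.single μ 1) = totL n μ * totPow β := by
  cases μ with
  | none =>
    simp only [totPow, Pi.add_apply, Pi.single_eq_same, pow_succ', mul_assoc]
    simp
  | some i =>
    have h1 : (fun j => (β + Pi.single (some i) 1 : MIdx n) (some j)) =
        (fun j => β (some j)) + Pi.single i 1 := by
      funext j; simp [Pi.single_apply]
    rw [totPow, totPow, h1, DxPowL_add_single, ← mul_assoc, ← mul_assoc,
      ((totL_commute (some i) none).pow_right (β none)).eq]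
    simp

theorem DxPowL_eq_totPow (α : Fin n → ℕ) : DxPowL α = totPow (midx 0 α) := by
  simp [totPow]

theorem totPow_add_single_apply (β : MIdx n) (μ : Option (Fin n)) (F : DF n) :
    totPow (β + Pi.single μ 1) F = totD μ (totPow β F) := by
  rw [totPow_add_single]; rfl

theorem totPow_coordD (β γ : MIdx n) :
    totPow β (coordD (uvar γ)) = coordD (uvar (γ + β)) := by
  induction β using multiIndex_induction with
  | zero => simp [totPow_zero]
  | add_single β μ ih => rw [totPow_add_single_apply, ih, totD_coordD, totCoord_uvar, add_assoc]

theorem coe_totPow (β : MIdx n) (F : DF n) :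
    (totPow β F : Jet n → ℝ) = Dt^[β none] (DxPow (fun i => β (some i)) (F : Jet n → ℝ)) := by
  rw [← coe_DxPowL]
  exact coe_totL_pow none _ _

/-! ### Dependence of total derivatives on jet coordinates -/

theorem bvar_mem_normalVars (N : ℕ) (μ : Option (Fin n)) : bvar μ ∈ normalVars n N := by
  intro j α h
  exact absurd h (bvar_ne_uvar μ (midx j α))

theorem uvar_mem_normalVars {N : ℕ} {β : MIdx n} : uvar β ∈ normalVars n N ↔ β none < N := by
  constructor
  · intro h
    exact h _ _ rfl
  · rintro h j α h'
    rw [← uvar_midx, uvar_inj] at h'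
    simpa [h'] using h

theorem normalVars_mono {N M : ℕ} (h : N ≤ M) : normalVars n N ⊆ normalVars n M :=
  fun _ hv j α e => (hv j α e).trans_le h

namespace IsDiffFunOf

variable {V W : Set (JetVar n)} {F G : Jet n → ℝ}

theorem isDiffFun (hF : IsDiffFunOf V F) : IsDiffFun F := hF.mono (Set.subset_univ _)

theorem neg (hF : IsDiffFunOf V F) : IsDiffFunOf V (-F) := by
  have h : -F = (fun _ => (-1 : ℝ)) * F := by funext z; simp
  rw [h]
  exact (IsDiffFunOf.const (-1 : ℝ)).mul hF

theorem sub (hF : IsDiffFunOf V F) (hG : IsDiffFunOf V G) : IsDiffFunOf V (F - G) := by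
  simpa [sub_eq_add_neg] using hF.add hG.neg

theorem sum {κ : Type*} {s : Finset κ} {F : κ → DF n}
    (hF : ∀ k ∈ s, IsDiffFunOf V (F k : Jet n → ℝ)) :
    IsDiffFunOf V ((∑ k ∈ s, F k : DF n) : Jet n → ℝ) :=
  Finset.sum_induction F (fun G : DF n => IsDiffFunOf V (G : Jet n → ℝ))
    (fun _ _ h h' => h.add h') (const 0) hF

theorem tot {μ : Option (Fin n)} (hF : IsDiffFunOf V F) (hVW : V ⊆ W)
    (h : ∀ v ∈ V, IsDiffFunOf W (totCoord μ v : Jet n → ℝ)) : IsDiffFunOf W (tot μ F) := by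
  obtain ⟨S, hS, hFS⟩ := isDiffFunOf_iff.1 hF
  have h1 := congrArg Subtype.val (totD_eq_sum μ (F := (⟨F, hF.isDiffFun⟩ : DF n)) hFS)
  rw [coe_totD] at h1
  rw [h1]
  exact sum fun v hv => (h v (hS hv)).mul ((hF.pd v).mono hVW)

end IsDiffFunOf

theorem isDiffFunOf_totCoord {V W : Set (JetVar n)} {μ : Option (Fin n)}
    (h : ∀ β, uvar β ∈ V → uvar (β + Pi.single μ 1) ∈ W) :
    ∀ v ∈ V, IsDiffFunOf W (totCoord μ v : Jet n → ℝ) := by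
  intro v hv
  induction v using JetVar.bvar_uvar_cases with
  | base κ =>
    rw [totCoord_bvar]
    split_ifs
    · exact .const 1
    · exact .const 0
  | jet β =>
    rw [totCoord_uvar]
    exact .coord (h β hv)

theorem IsNormal.Dx {N : ℕ} {F : Jet n → ℝ} (hF : IsNormal N F) (i : Fin n) :
    IsNormal N (Dx i F) :=
  IsDiffFunOf.tot (μ := some i) hF subset_rfl (isDiffFunOf_totCoord fun β hβ => by
    simpa [uvar_mem_normalVars] using hβ)

theorem IsNormal.Dt {N : ℕ} {F : Jet n → ℝ} (hF : IsNormal N F) :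
    IsNormal (N + 1) (Dt F) :=
  IsDiffFunOf.tot (μ := none) hF (normalVars_mono N.le_succ) (isDiffFunOf_totCoord fun β hβ => by
    simpa [uvar_mem_normalVars] using hβ)

theorem IsNormal.totPow {N : ℕ} {F : DF n} (hF : IsNormal N (F : Jet n → ℝ)) (β : MIdx n) :
    IsNormal (N + β none) (totPow β F : Jet n → ℝ) := by
  induction β using multiIndex_induction with
  | zero => simpa [totPow_zero] using hF
  | add_single β μ ih =>
    rw [totPow_add_single_apply]
    cases μ with
    | none => exact IsNormal.Dt ih
    | some i =>
      rw [Pi.add_apply, Pi.single_eq_of_ne (by simp), add_zero]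
      exact IsNormal.Dx ih i

theorem IsNormal.DxPowL {N : ℕ} {F : DF n} (hF : IsNormal N (F : Jet n → ℝ)) (α : Fin n → ℕ) :
    IsNormal N (DxPowL α F : Jet n → ℝ) := by
  rw [DxPowL_eq_totPow]
  exact hF.totPow (midx 0 α)

/-! ### The solution space -/

/-- The left side of the PDE as a differential function. -/
def pdeD (N : ℕ) (g : DF n) : DF n := coordD (uvar (midx N 0)) + g

@[simp] theorem coe_pdeD (N : ℕ) (g : DF n) : (pdeD N g : Jet n → ℝ) = pde N g := rfl

theorem pdeCons_eq (N : ℕ) (g : DF n) (j : ℕ) (α : Fin n → ℕ) :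
    pdeCons N g j α = (totPow (midx j α) (pdeD N g) : Jet n → ℝ) := by
  rw [coe_totPow]; rfl

theorem totPow_pdeD (N : ℕ) (g : DF n) (β : MIdx n) :
    totPow β (pdeD N g) = coordD (uvar (midx N 0 + β)) + totPow β g := by
  rw [pdeD, map_add, totPow_coordD]

theorem midx_add_midx (N j : ℕ) (α : Fin n → ℕ) : midx N 0 + midx j α = midx (N + j) α := by
  funext o; cases o <;> simp

theorem mem_solutionSpace_iff {N : ℕ} {g : DF n} {z : Jet n} :
    z ∈ solutionSpace N (g : Jet n → ℝ) ↔
      ∀ j α, z (.u (N + j) α) = -(totPow (midx j α) g : Jet n → ℝ) z := by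
  refine forall₂_congr fun j α => ?_
  rw [pdeCons_eq, totPow_pdeD, midx_add_midx, uvar_midx]
  exact add_eq_zero_iff_eq_neg

/-- The values on the solution space of the coordinates `∂_t^j ∂_x^α u`, determined by the values
of the coordinates with `j < N`. -/
noncomputable def solve (N : ℕ) (g : DF n) (z : Jet n) (j : ℕ) (α : Fin n → ℕ) : ℝ :=
  if j < N then z (.u j α) else
    -(totPow (midx (j - N) α) g : Jet n → ℝ) fun
      | .t => z .t
      | .x i => z (.x i)
      -- The value `0` is never read when `g` is normal: `D_t^{j-N} D_x^α g` then involves only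
      -- `t`-derivatives of `u` of order below `j`.
      | .u k β => if _ : k < j then solve N g z k β else 0
termination_by j

/-- The projection of the jet space onto the solution space along the coordinates
`∂_t^j ∂_x^α u` with `j ≥ N`. -/
noncomputable def proj (N : ℕ) (g : DF n) (z : Jet n) : Jet n
  | .t => z .t
  | .x i => z (.x i)
  | .u j α => solve N g z j α

theorem proj_u_of_lt {N j : ℕ} (h : j < N) (g : DF n) (z : Jet n) (α : Fin n → ℕ) :
    proj N g z (.u j α) = z (.u j α) := by
  rw [proj, solve, if_pos h]

theorem proj_of_mem_normalVars {N : ℕ} (g : DF n) (z : Jet n) {v : JetVar n}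
    (hv : v ∈ normalVars n N) : proj N g z v = z v := by
  cases v with
  | t => rfl
  | x i => rfl
  | u j α => exact proj_u_of_lt (hv j α rfl) g z α

theorem proj_u_add {N : ℕ} {g : DF n} (hg : IsNormal N (g : Jet n → ℝ)) (z : Jet n) (j : ℕ)
    (α : Fin n → ℕ) :
    proj N g z (.u (N + j) α) = -(totPow (midx j α) g : Jet n → ℝ) (proj N g z) := by
  rw [proj, solve, if_neg (by omega), Nat.add_sub_cancel_left]
  congr 1
  refine (hg.totPow (midx j α)).dependsOn fun v hv => ?_
  cases v with
  | t => rfl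
  | x i => rfl
  | u k β =>
    have : k < N + j := hv k β rfl
    simp [proj, this]

theorem proj_mem {N : ℕ} {g : DF n} (hg : IsNormal N (g : Jet n → ℝ)) (z : Jet n) :
    proj N g z ∈ solutionSpace N (g : Jet n → ℝ) :=
  mem_solutionSpace_iff.2 fun j α => proj_u_add hg z j α

/-- Induction on the jet coordinates in the order in which the PDE determines them. -/
@[elab_as_elim]
theorem normalVars_induction {N : ℕ} {P : JetVar n → Prop} (v : JetVar n)
    (normal : ∀ v ∈ normalVars n N, P v)
    (step : ∀ j α, (∀ w ∈ normalVars n (N + j), P w) → P (.u (N + j) α)) : P v := by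
  have key : ∀ j, ∀ w ∈ normalVars n (N + j), P w := by
    intro j
    induction j with
    | zero => exact normal
    | succ j ih =>
      intro w hw
      by_cases hw' : w ∈ normalVars n (N + j)
      · exact ih w hw'
      · induction w using JetVar.bvar_uvar_cases with
        | base κ => exact absurd (bvar_mem_normalVars _ κ) hw'
        | jet β =>
          rw [uvar_mem_normalVars] at hw hw'
          have := step j (fun i => β (some i)) ih
          rwa [show N + j = β none by omega] at this
  cases v with
  | t => exact key 0 _ (bvar_mem_normalVars _ none)
  | x i => exact key 0 _ (bvar_mem_normalVars _ (some i))
  | u j α => exact key (j + 1) _ (uvar_mem_normalVars (β := midx j α) |>.2 (by simp; omega))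

theorem proj_eq_self {N : ℕ} {g : DF n} (hg : IsNormal N (g : Jet n → ℝ)) {z : Jet n}
    (hz : z ∈ solutionSpace N (g : Jet n → ℝ)) : proj N g z = z := by
  funext v
  induction v using normalVars_induction (N := N) with
  | normal v hv => exact proj_of_mem_normalVars g z hv
  | step j α ih =>
    rw [proj_u_add hg, mem_solutionSpace_iff.1 hz, (hg.totPow (midx j α)).dependsOn ih]

theorem IsDiffFunOf.comp_proj {N : ℕ} {g : DF n} {V : Set (JetVar n)} {F : Jet n → ℝ}
    (hF : IsDiffFunOf V F) (h : ∀ v ∈ V, IsNormal N fun z => proj N g z v) :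
    IsNormal N fun z => F (proj N g z) := by
  obtain ⟨S, hS, f, hf, hF⟩ := hF
  simp only [hF]
  exact IsDiffFunOf.comp hf fun v => h v (hS v.2)

theorem isNormal_proj {N : ℕ} {g : DF n} (hg : IsNormal N (g : Jet n → ℝ)) (v : JetVar n) :
    IsNormal N fun z => proj N g z v := by
  induction v using normalVars_induction (N := N) with
  | normal v hv =>
    simp only [proj_of_mem_normalVars g _ hv]
    exact IsDiffFunOf.coord hv
  | step j α ih =>
    simp only [proj_u_add hg]
    exact IsDiffFunOf.neg (IsDiffFunOf.comp_proj (hg.totPow (midx j α)) ih)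

/-- The pullback of a differential function along the projection onto the solution space. -/
noncomputable def pullback {N : ℕ} {g : DF n} (hg : IsNormal N (g : Jet n → ℝ)) (F : DF n) :
    DF n :=
  ⟨fun z => (F : Jet n → ℝ) (proj N g z),
    (F.2.comp_proj fun v _ => isNormal_proj hg v).isDiffFun⟩

theorem isNormal_pullback {N : ℕ} {g : DF n} (hg : IsNormal N (g : Jet n → ℝ)) (F : DF n) :
    IsNormal N (pullback hg F : Jet n → ℝ) :=
  F.2.comp_proj fun v _ => isNormal_proj hg v

/-- The chain rule for `F ∘ proj`, with `proj z = z` at points of the solution space, reduces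
tangency to the coordinates on which `F` depends. -/
theorem tot_pullback_aux {N : ℕ} {g : DF n} (hg : IsNormal N (g : Jet n → ℝ)) {F : DF n}
    {V : Set (JetVar n)} (hF : IsDiffFunOf V (F : Jet n → ℝ)) (μ : Option (Fin n)) {z : Jet n}
    (hz : z ∈ solutionSpace N (g : Jet n → ℝ))
    (h : ∀ v ∈ V, tot μ (pullback hg (coordD v)) z = (totCoord μ v : Jet n → ℝ) z) :
    tot μ (pullback hg F) z = tot μ F z := by
  obtain ⟨S, hS, hFS⟩ := isDiffFunOf_iff.1 hF
  have h1 := hFS.hasDerivAt_curve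
    (γ := fun s => proj N g fun v => z v + s * (totCoord μ v : Jet n → ℝ) z)
    (w := fun v => tot μ (pullback hg (coordD v)) z) (s₀ := 0)
    fun v _ => hasDerivAt_tot μ (pullback hg (coordD v)) z
  rw [(hasDerivAt_tot μ (pullback hg F) z).unique h1, tot_eq_sum μ hFS]
  refine Finset.sum_congr rfl fun v hv => ?_
  simp [h v (hS hv), proj_eq_self hg hz]

/-- The total derivatives are tangent to the solution space. -/
theorem tot_pullback {N : ℕ} {g : DF n} (hg : IsNormal N (g : Jet n → ℝ)) (F : DF n)
    (μ : Option (Fin n)) {z : Jet n} (hz : z ∈ solutionSpace N (g : Jet n → ℝ)) :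
    tot μ (pullback hg F) z = tot μ F z := by
  refine tot_pullback_aux hg F.2 μ hz fun v hv => ?_
  clear hv
  induction v using normalVars_induction (N := N) with
  | normal v hv =>
    have : pullback hg (coordD v) = coordD v :=
      Subtype.ext (funext fun z => proj_of_mem_normalVars g z hv)
    rw [this, ← coe_totD, totD_coordD]
  -- On the image of the projection this coordinate is `-D_t^j D_x^α g`. Its total derivative is
  -- known by induction, and the next differential consequence of the PDE identifies it with the
  -- shifted coordinate.
  | step j α ih =>
    have h1 : pullback hg (coordD (.u (N + j) α)) = -pullback hg (totPow (midx j α) g) :=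
      Subtype.ext (funext fun z => proj_u_add hg z j α)
    have h2 := tot_pullback_aux hg (hg.totPow (midx j α)) μ hz ih
    rw [h1, ← coe_totD, map_neg, NegMemClass.coe_neg, Pi.neg_apply, coe_totD, h2, ← coe_totD,
      ← totPow_add_single_apply, ← uvar_midx, totCoord_uvar, coordD_apply]
    cases μ with
    | none =>
      rw [midx_add_single_none, midx_add_single_none, uvar_midx, add_assoc]
      exact (mem_solutionSpace_iff.1 hz _ _).symm
    | some i =>
      rw [midx_add_single_some, midx_add_single_some, uvar_midx]
      exact (mem_solutionSpace_iff.1 hz _ _).symm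

theorem IsNormal.eq_of_eqOn_solutionSpace {N : ℕ} {g : DF n} (hg : IsNormal N (g : Jet n → ℝ))
    {F G : Jet n → ℝ} (hF : IsNormal N F) (hG : IsNormal N G)
    (h : ∀ z ∈ solutionSpace N (g : Jet n → ℝ), F z = G z) : F = G := by
  funext z
  have hp : ∀ v ∈ normalVars n N, z v = proj N g z v :=
    fun v hv => (proj_of_mem_normalVars g z hv).symm
  rw [hF.dependsOn hp, hG.dependsOn hp]
  exact h _ (proj_mem hg z)

/-! ### The restricted Euler operator -/

/-- The adjoint of the part of a differential operator that acts on `∂_t^r u` and its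
`x`-derivatives, applied to `1`. -/
noncomputable def eulerL (r : ℕ) : (MIdx n →₀ DF n) →ₗ[ℝ] DF n :=
  Finsupp.lsum ℝ fun β =>
    if β none = r then (-1 : ℝ) ^ (∑ i, β (some i)) • DxPowL fun i => β (some i) else 0

theorem eulerL_single (r : ℕ) (β : MIdx n) (F : DF n) :
    eulerL r (Finsupp.single β F) =
      if β none = r then (-1 : ℝ) ^ (∑ i, β (some i)) • DxPowL (fun i => β (some i)) F else 0 := by
  rw [eulerL, Finsupp.lsum_single]
  split_ifs <;> rfl

theorem midx_injective (r : ℕ) : Function.Injective (midx (n := n) r) := by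
  intro α α' h
  funext i
  exact congrFun h (some i)

/-- Presents the restricted Euler operator as a linear map after the Fréchet derivative, so that its
action on total derivatives can be computed from `nabla`. -/
theorem coe_eulerL_frechet (r : ℕ) (F : DF n) :
    (eulerL r (frechet F) : Jet n → ℝ) = restrictedEuler r (F : Jet n → ℝ) := by
  classical
  funext z
  rw [restrictedEuler, finsum_eq_sum_of_support_subset
    (s := (frechet F).support.preimage (midx r) (midx_injective r).injOn)]
  · rw [eulerL, Finsupp.lsum_apply, Finsupp.sum, ← Finset.sum_preimage (midx r) _
      (midx_injective r).injOn]
    · simp only [AddSubmonoidClass.coe_finsetSum, Finset.sum_apply, midx_none, if_true, midx_some,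
        LinearMap.smul_apply, SetLike.val_smul, Pi.smul_apply, smul_eq_mul, frechet_apply,
        coe_DxPowL, coe_pdD, uvar_midx]
    · intro β _ hβ
      rw [if_neg, LinearMap.zero_apply]
      rintro rfl
      exact hβ ⟨_, midx_eta β⟩
  · intro α hα
    simp only [Finset.coe_preimage, Set.mem_preimage, Finset.mem_coe, Finsupp.mem_support_iff,
      frechet_apply, uvar_midx]
    intro h
    refine hα ?_
    simp only [← coe_pdD, h, ← coe_DxPowL, map_zero]
    simp

theorem eulerL_congr {r : ℕ} {C C' : MIdx n →₀ DF n} (h : ∀ β, β none = r → C β = C' β) :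
    eulerL r C = eulerL r C' := by
  rw [← sub_eq_zero, ← map_sub, eulerL, Finsupp.lsum_apply]
  refine Finset.sum_eq_zero fun β _ => ?_
  by_cases hβ : β none = r
  · simp [h β hβ]
  · simp [hβ]

/-- The two terms of `D_i ∘ (F D^β)` have the same order in `t` and give the same derivative of `F`,
with opposite signs since their orders in `x` differ by one. -/
theorem eulerL_nabla_some (r : ℕ) (i : Fin n) (C : MIdx n →₀ DF n) :
    eulerL r (nabla (totL n) (some i) C) = 0 := by
  induction C using Finsupp.induction_linear with
  | zero => simp
  | add C C' h h' => simp [h, h']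
  | single β F =>
    have h1 : (fun j => (β + Pi.single (some i) 1 : MIdx n) (some j)) =
        (fun j => β (some j)) + Pi.single i 1 := by
      funext j; simp [Pi.single_apply]
    have h2 : ∑ j, (β + Pi.single (some i) 1 : MIdx n) (some j) = ∑ j, β (some j) + 1 := by
      simp [Finset.sum_add_distrib, Pi.single_apply]
    have h3 : DxPowL (fun j => β (some j)) (totL n (some i) F) =
        (totL n (some i) * DxPowL fun j => β (some j)) F := by
      rw [(commute_totL_DxPowL (some i) _).eq]; rfl
    rw [nabla_single, map_add, eulerL_single, eulerL_single, h2, h1, DxPowL_add_single, h3]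
    simp only [Pi.add_apply, ne_eq, reduceCtorEq, not_false_eq_true, Pi.single_eq_of_ne, add_zero]
    split_ifs
    · rw [pow_succ, mul_neg_one, neg_smul, add_neg_cancel]
    · exact add_zero 0

theorem eulerL_frechet_totD_some (r : ℕ) (i : Fin n) (F : DF n) :
    eulerL r (frechet (totD (some i) F)) = 0 := by
  rw [frechet_totD, eulerL_nabla_some]

theorem pdD_eq_zero_of_isNormal {N : ℕ} {F : DF n} (hF : IsNormal N (F : Jet n → ℝ)) {β : MIdx n}
    (hβ : N ≤ β none) : pdD (uvar β) F = 0 :=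
  Subtype.ext (IsDiffFunOf.pd_eq_zero hF (by simpa [uvar_mem_normalVars] using hβ))

/-- Normality leaves no term of `t`-order `r + 1` in the linearization of `F`, so only terms of
`t`-order `r`, shifted by `D_t`, contribute. -/
theorem eulerL_frechet_totD_none {r : ℕ} {F : DF n} (hF : IsNormal (r + 1) (F : Jet n → ℝ)) :
    eulerL (r + 1) (frechet (totD none F)) = eulerL r (frechet F) := by
  rw [frechet_totD]
  conv_lhs => rw [← (frechet F).sum_single, map_finsuppSum, map_finsuppSum]
  conv_rhs => rw [← (frechet F).sum_single, map_finsuppSum]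
  refine Finsupp.sum_congr fun β hβ => ?_
  have hβ' : β none ≠ r + 1 := by
    intro h
    exact Finsupp.mem_support_iff.1 hβ (pdD_eq_zero_of_isNormal hF h.ge)
  rw [nabla_single, map_add, eulerL_single, eulerL_single, eulerL_single, if_neg hβ', zero_add]
  simp

/-- Since `g` and `L` are normal, the only term of `t`-order `N` in the linearization of `G L` is `L
∂_t^N`, from the leading coordinate of `G`. -/
theorem eulerL_frechet_pdeD_mul {N : ℕ} {g L : DF n} (hg : IsNormal N (g : Jet n → ℝ))
    (hL : IsNormal N (L : Jet n → ℝ)) : eulerL N (frechet (pdeD N g * L)) = L := by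
  rw [eulerL_congr (C' := Finsupp.single (midx N 0) L), eulerL_single]
  · rw [if_pos (midx_none N 0)]
    change (-1 : ℝ) ^ (∑ i, (0 : Fin n → ℕ) i) • DxPowL 0 L = L
    simp [DxPowL_zero]
  · intro β hβ
    rw [frechet_apply, Derivation.leibniz, pdD_eq_zero_of_isNormal hL hβ.ge, pdeD, map_add,
      pdD_eq_zero_of_isNormal hg hβ.ge, pdD_coordD, Finsupp.single_apply]
    simp only [uvar_inj, eq_comm (a := β)]
    split_ifs <;> simp

theorem isNormal_eulerL_frechet {N r : ℕ} {F : DF n} (hF : IsNormal N (F : Jet n → ℝ)) :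
    IsNormal N (eulerL r (frechet F) : Jet n → ℝ) := by
  rw [eulerL, Finsupp.lsum_apply]
  refine IsDiffFunOf.sum fun β _ => ?_
  dsimp only
  split_ifs
  · have h : IsNormal N (DxPowL (fun i => β (some i)) (pdD (uvar β) F) : Jet n → ℝ) :=
      IsNormal.DxPowL (F := pdD (uvar β) F) (IsDiffFunOf.pd hF _) _
    exact (IsDiffFunOf.const ((-1 : ℝ) ^ ∑ i, β (some i))).mul h
  · exact IsDiffFunOf.const 0

/-! ### Multipliers -/

/-- The module generated by the PDE and its differential consequences. -/
noncomputable def pdeSpan (N : ℕ) (g : DF n) : Submodule (DF n) (DF n) :=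
  Submodule.span (DF n)
    (Set.range fun p : ℕ × (Fin n → ℕ) => totPow (midx p.1 p.2) (pdeD N g))

theorem mem_pdeSpan {N : ℕ} {g : DF n} {Γ : DF n} (h : Γ ∈ pdeSpan N g) :
    IsProportionalToPDE N (g : Jet n → ℝ) Γ := by
  obtain ⟨c, rfl⟩ := Finsupp.mem_span_range_iff_exists_finsupp.1 h
  refine ⟨c.support, fun p => c p, fun p => (c p).2, fun z => ?_⟩
  simp [Finsupp.sum, Finset.sum_apply, pdeCons_eq]

theorem IsProportionalToPDE.isDiffFun {N : ℕ} {g : DF n} {Γ : Jet n → ℝ}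
    (h : IsProportionalToPDE N (g : Jet n → ℝ) Γ) : IsDiffFun Γ := by
  obtain ⟨S, c, hc, hΓ⟩ := h
  have : Γ = ((∑ p ∈ S, (⟨c p, hc p⟩ : DF n) * totPow (midx p.1 p.2) (pdeD N g) : DF n) :
      Jet n → ℝ) := by
    funext z
    simp [hΓ, Finset.sum_apply, pdeCons_eq]
  rw [this]
  exact Subtype.prop _

theorem IsProportionalToPDE.eq_zero {N : ℕ} {g Γ : Jet n → ℝ} (h : IsProportionalToPDE N g Γ)
    {z : Jet n} (hz : z ∈ solutionSpace N g) : Γ z = 0 := by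
  obtain ⟨S, c, -, hΓ⟩ := h
  rw [hΓ]
  exact Finset.sum_eq_zero fun p _ => by rw [hz, mul_zero]

theorem exists_integration_by_parts {N : ℕ} {g : DF n} (α : Fin n → ℕ) (F : DF n) :
    ∃ Γ : Fin n → DF n, (∀ i, Γ i ∈ pdeSpan N g) ∧
      F * DxPowL α (pdeD N g) =
        ((-1 : ℝ) ^ (∑ i, α i) • DxPowL α F) * pdeD N g + ∑ i, totD (some i) (Γ i) := by
  induction α using multiIndex_induction generalizing F with
  | zero => exact ⟨0, fun i => zero_mem _, by simp [DxPowL_zero]⟩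
  | add_single α i ih =>
    obtain ⟨Γ, hΓ, h⟩ := ih (totD (some i) F)
    -- From `F D_i D_x^α G = D_i (F D_x^α G) - (D_i F) D_x^α G`, with the induction hypothesis
    -- applied to `D_i F`.
    refine ⟨Pi.single i (F * DxPowL α (pdeD N g)) - Γ, fun j => sub_mem ?_ (hΓ j), ?_⟩
    · rcases eq_or_ne j i with rfl | hj
      · rw [Pi.single_eq_same, DxPowL_eq_totPow]
        exact Submodule.smul_mem _ _ (Submodule.subset_span ⟨(0, α), rfl⟩)
      · rw [Pi.single_eq_of_ne hj]
        exact zero_mem _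
    · have h1 : ∑ j, totD (some j) ((Pi.single i (F * DxPowL α (pdeD N g)) - Γ : Fin n → DF n) j) =
          totD (some i) (F * DxPowL α (pdeD N g)) - ∑ j, totD (some j) (Γ j) := by
        simp only [Pi.sub_apply, map_sub, Finset.sum_sub_distrib]
        congr 1
        rw [Finset.sum_eq_single i (fun j _ hj => by rw [Pi.single_eq_of_ne hj, map_zero])
          (by simp), Pi.single_eq_same]
      have h2 : ∑ j, (α + Pi.single i 1 : Fin n → ℕ) j = ∑ j, α j + 1 := by
        simp [Finset.sum_add_distrib]
      have h3 : DxPowL α (totD (some i) F) = DxPowL (α + Pi.single i 1) F := by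
        rw [DxPowL_add_single, (commute_totL_DxPowL (some i) α).eq]; rfl
      have h4 : DxPowL (α + Pi.single i 1) (pdeD N g) = totD (some i) (DxPowL α (pdeD N g)) := by
        rw [DxPowL_add_single]; rfl
      have h5 : ((-1 : ℝ) ^ (∑ j, α j + 1) • DxPowL (α + Pi.single i 1) F) * pdeD N g =
          -(((-1 : ℝ) ^ (∑ j, α j) • DxPowL (α + Pi.single i 1) F) * pdeD N g) := by
        rw [pow_succ, mul_neg_one, neg_smul]
        exact neg_mul ((-1 : ℝ) ^ (∑ j, α j) • DxPowL (α + Pi.single i 1) F) (pdeD N g)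
      rw [h3] at h
      rw [h1, h2, h4, h5, Derivation.leibniz, smul_eq_mul, smul_eq_mul,
        mul_comm (DxPowL α (pdeD N g)), h]
      abel

/-- Only derivatives of `Φ` along coordinates of `t`-order `r` bring in `∂_t^{r+1} u`; there `D_x^α
G - D_x^α g` is substituted for `D_x^α ∂_t^{r+1} u`. -/
theorem exists_totD_none_eq {r : ℕ} {g Φ : DF n} (hg : IsNormal (r + 1) (g : Jet n → ℝ))
    (hΦ : IsNormal (r + 1) (Φ : Jet n → ℝ)) :
    ∃ R : DF n, IsNormal (r + 1) (R : Jet n → ℝ) ∧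
      totD none Φ = R + (frechet Φ).sum fun β F =>
        if β none = r then F * DxPowL (fun i => β (some i)) (pdeD (r + 1) g) else 0 := by
  classical
  obtain ⟨S, hS, hΦS⟩ := isDiffFunOf_iff.1 hΦ
  have key : ∀ β : MIdx n, β none = r →
      DxPowL (fun i => β (some i)) (pdeD (r + 1) g) =
        totCoord none (uvar β) + DxPowL (fun i => β (some i)) g := by
    intro β hβ
    rw [DxPowL_eq_totPow, totPow_pdeD, midx_add_midx, totCoord_uvar]
    congr 3
    conv_rhs => rw [← midx_eta β, midx_add_single_none, hβ]
  have hsum : totD none Φ = ∑ v ∈ S.filter (· ∉ Set.range uvar), totCoord none v * pdD v Φ +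
      (frechet Φ).sum fun β F => totCoord none (uvar β) * F := by
    rw [totD_eq_sum none hΦS, ← Finset.sum_filter_not_add_sum_filter S (· ∈ Set.range uvar)]
    congr 1
    rw [Finsupp.sum_of_support_subset (s := S.preimage uvar uvar_injective.injOn) _
      (fun β hβ => ?_) _ (by simp)]
    · simp only [frechet_apply]
      rw [Finset.sum_preimage' uvar S uvar_injective.injOn fun v => totCoord none v * pdD v Φ]
    · by_contra hh
      exact Finsupp.mem_support_iff.1 hβ (pdD_eq_zero hΦS (by simpa using hh))
  refine ⟨∑ v ∈ S.filter (· ∉ Set.range uvar), totCoord none v * pdD v Φ +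
    (frechet Φ).sum fun β F => if β none = r then -(F * DxPowL (fun i => β (some i)) g) else
      totCoord none (uvar β) * F, IsDiffFunOf.add (IsDiffFunOf.sum fun v hv => ?_)
      (IsDiffFunOf.sum fun β hβ => ?_), ?_⟩
  · refine IsDiffFunOf.mul ?_ (IsDiffFunOf.pd hΦ v)
    obtain ⟨-, hv⟩ := Finset.mem_filter.1 hv
    induction v using JetVar.bvar_uvar_cases with
    | base κ =>
      exact isDiffFunOf_totCoord (V := Set.range bvar) (by simp) _ (Set.mem_range_self κ)
    | jet β => exact absurd (Set.mem_range_self β) hv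
  · have h1 : IsNormal (r + 1) (frechet Φ β : Jet n → ℝ) := IsDiffFunOf.pd hΦ _
    dsimp only
    split_ifs with h
    · exact (h1.mul (hg.DxPowL _)).neg
    · refine IsDiffFunOf.mul ?_ h1
      have h2 : β none < r + 1 := by
        by_contra hh
        exact Finsupp.mem_support_iff.1 hβ (pdD_eq_zero_of_isNormal hΦ (by omega))
      rw [totCoord_uvar]
      exact IsDiffFunOf.coord (uvar_mem_normalVars.2 (by simp; omega))
  · rw [hsum, add_assoc, ← Finsupp.sum_add]
    congr 1
    refine Finsupp.sum_congr fun β _ => ?_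
    split_ifs with h
    · rw [key β h]
      ring
    · rw [add_zero]

/-- A conservation law has its restricted Euler derivative as a multiplier. -/
theorem exists_multiplier_identity {r : ℕ} {g Φ : DF n} {Ψ : Fin n → DF n}
    (hg : IsNormal (r + 1) (g : Jet n → ℝ))
    (h : IsConservationLaw (r + 1) (g : Jet n → ℝ) Φ fun i => (Ψ i : Jet n → ℝ)) :
    ∃ Γ : Fin n → DF n, (∀ i, Γ i ∈ pdeSpan (r + 1) g) ∧
      pdeD (r + 1) g * eulerL r (frechet Φ) =
        totD none Φ + ∑ i, totD (some i) (Ψ i - Γ i) := by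
  obtain ⟨R, hR, hΦR⟩ := exists_totD_none_eq hg h.normal_t
  choose Γ hΓ hparts using exists_integration_by_parts (n := n) (N := r + 1) (g := g)
  -- On the solution space the terms with `D_x^α G` drop out, so this is the conservation law there;
  -- both sides are normal, so it holds everywhere.
  have hvanish : R + ∑ i, totD (some i) (Ψ i) = 0 := by
    refine Subtype.ext (hg.eq_of_eqOn_solutionSpace (G := 0)
      (IsDiffFunOf.add hR (IsDiffFunOf.sum fun i _ => (h.normal_x i).Dx i))
      (IsDiffFunOf.const 0) fun z hz => ?_)
    have h1 := h.conserved z hz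
    have h2 : Dt Φ z = (R : Jet n → ℝ) z := by
      have := congrFun (congrArg Subtype.val hΦR) z
      refine this.trans ?_
      simp only [AddMemClass.coe_add, Pi.add_apply, Finsupp.sum, AddSubmonoidClass.coe_finsetSum,
        Finset.sum_apply]
      rw [Finset.sum_eq_zero, add_zero]
      intro β _
      split_ifs
      · have h3 : (DxPowL (fun i => β (some i)) (pdeD (r + 1) g) : Jet n → ℝ) z = 0 := by
          rw [DxPowL_eq_totPow, ← pdeCons_eq]
          exact hz _ _
        simp [h3]
      · rfl
    rw [h2] at h1
    simpa [Finset.sum_apply, tot] using h1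
  refine ⟨fun i => (frechet Φ).sum fun β F => if β none = r then
    Γ (fun j => β (some j)) F i else 0, fun i => Submodule.sum_mem _ fun β _ => ?_, ?_⟩
  · dsimp only
    split_ifs
    · exact hΓ _ _ i
    · exact zero_mem _
  · have h1 : totD none Φ + ∑ i, totD (some i) (Ψ i) = (frechet Φ).sum fun β F =>
        if β none = r then F * DxPowL (fun i => β (some i)) (pdeD (r + 1) g) else 0 := by
      rw [hΦR, add_right_comm, hvanish, zero_add]
    simp only [map_sub, Finset.sum_sub_distrib]
    rw [add_sub, h1, eulerL, Finsupp.lsum_apply]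
    simp only [Finsupp.sum, map_sum, Finset.mul_sum]
    rw [Finset.sum_comm, ← Finset.sum_sub_distrib]
    refine Finset.sum_congr rfl fun β _ => ?_
    split_ifs
    · rw [hparts, add_sub_cancel_right, mul_comm]
      rfl
    · simp

theorem multiplier_unique {r : ℕ} {g Φ L : DF n} {Θ : Fin n → DF n}
    (hg : IsNormal (r + 1) (g : Jet n → ℝ)) (hΦ : IsNormal (r + 1) (Φ : Jet n → ℝ))
    (hL : IsNormal (r + 1) (L : Jet n → ℝ))
    (h : pdeD (r + 1) g * L = totD none Φ + ∑ i, totD (some i) (Θ i)) :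
    L = eulerL r (frechet Φ) := by
  rw [← eulerL_frechet_pdeD_mul hg hL, h, map_add, map_add, map_sum, map_sum,
    Finset.sum_eq_zero fun i _ => eulerL_frechet_totD_some _ i _, add_zero,
    eulerL_frechet_totD_none hΦ]

/-! ### Trivial conservation laws -/

/-- Spatial total derivatives preserve normality, so `Φ = D_i θ^i` extends from the solution space
to all jets, where the Euler operator annihilates it. -/
theorem eulerL_frechet_eq_zero_of_isTrivial {r N : ℕ} {g Φ : DF n} {Ψ : Fin n → Jet n → ℝ}
    (hg : IsNormal N (g : Jet n → ℝ)) (hΦ : IsNormal N (Φ : Jet n → ℝ))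
    (h : IsTrivial N (g : Jet n → ℝ) Φ Ψ) : eulerL r (frechet Φ) = 0 := by
  obtain ⟨θ, ψ, hθ, -, -, hz⟩ := h
  have h1 : Φ = ∑ i, totD (some i) (⟨θ i, (hθ i).isDiffFun⟩ : DF n) := by
    refine Subtype.ext (hg.eq_of_eqOn_solutionSpace hΦ
      (IsDiffFunOf.sum fun i _ => (hθ i).Dx i) fun z hzS => ?_)
    simpa [Finset.sum_apply, tot] using (hz z hzS).1
  rw [h1, map_sum, map_sum]
  exact Finset.sum_eq_zero fun i _ => eulerL_frechet_totD_some r i _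

theorem isTrivial_of_eulerL_frechet_eq_zero (hn : n ≠ 0) {r : ℕ} {g Φ : DF n} {Ψ : Fin n → DF n}
    (hg : IsNormal (r + 1) (g : Jet n → ℝ))
    (h : IsConservationLaw (r + 1) (g : Jet n → ℝ) Φ fun i => (Ψ i : Jet n → ℝ))
    (hE : eulerL r (frechet Φ) = 0) :
    IsTrivial (r + 1) (g : Jet n → ℝ) Φ fun i => (Ψ i : Jet n → ℝ) := by
  obtain ⟨Γ, hΓ, hid⟩ := exists_multiplier_identity hg h
  rw [hE, mul_zero] at hid
  obtain ⟨ψ, hψ, hA⟩ := exists_curl hn (fun μ => μ.elim Φ fun i => Ψ i - Γ i) (by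
    rw [Fintype.sum_option]
    exact hid.symm)
  -- The mixed components of the curl potential give `θ`, the spatial ones `ψ^{ij}`. Antisymmetry
  -- removes the `tt` component and accounts for the sign of `D_t θ^i`.
  refine ⟨fun i => pullback hg (ψ none (some i)), fun i j => pullback hg (ψ (some i) (some j)),
    fun i => isNormal_pullback hg _, fun i j => isNormal_pullback hg _, fun i j => ?_,
    fun z hz => ⟨?_, fun i => ?_⟩⟩
  · funext z
    simp only [hψ (some i) (some j)]
    rfl
  · have h0 : ψ none none = 0 := Subtype.ext <| funext fun z => by
      have h : (ψ none none : Jet n → ℝ) z = -(ψ none none : Jet n → ℝ) z :=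
        congrFun (congrArg Subtype.val (hψ none none)) z
      change (ψ none none : Jet n → ℝ) z = 0
      linarith
    have h1 := congrFun (congrArg Subtype.val (hA none)) z
    rw [Fintype.sum_option, h0, map_zero, zero_add] at h1
    refine h1.trans ?_
    simp only [AddSubmonoidClass.coe_finsetSum, Finset.sum_apply, coe_totD]
    exact Finset.sum_congr rfl fun i _ => (tot_pullback hg _ (some i) hz).symm
  · have h1 := congrFun (congrArg Subtype.val (hA (some i))) z
    rw [Fintype.sum_option, hψ (some i) none, map_neg] at h1
    have h2 : (Γ i : Jet n → ℝ) z = 0 := (mem_pdeSpan (hΓ i)).eq_zero hz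
    simp only [Option.elim, AddSubgroupClass.coe_sub, Pi.sub_apply, h2, sub_zero,
      AddMemClass.coe_add, Pi.add_apply, NegMemClass.coe_neg, Pi.neg_apply,
      AddSubmonoidClass.coe_finsetSum, Finset.sum_apply, coe_totD] at h1
    refine h1.trans ?_
    congr 1
    · exact congrArg Neg.neg (tot_pullback hg _ none hz).symm
    · exact Finset.sum_congr rfl fun j _ => (tot_pullback hg _ (some j) hz).symm

theorem IsConservationLaw.sub {N : ℕ} {g Φ Φ' : DF n} {Ψ Ψ' : Fin n → DF n}
    (h : IsConservationLaw N (g : Jet n → ℝ) Φ fun i => (Ψ i : Jet n → ℝ))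
    (h' : IsConservationLaw N (g : Jet n → ℝ) Φ' fun i => (Ψ' i : Jet n → ℝ)) :
    IsConservationLaw N (g : Jet n → ℝ) (Φ - Φ' : DF n)
      fun i => ((Ψ i - Ψ' i : DF n) : Jet n → ℝ) where
  normal_t := IsDiffFunOf.sub h.normal_t h'.normal_t
  normal_x i := IsDiffFunOf.sub (h.normal_x i) (h'.normal_x i)
  conserved z hz := by
    have h1 : Dt ((Φ - Φ' : DF n) : Jet n → ℝ) z = Dt Φ z - Dt Φ' z :=
      congrFun (congrArg Subtype.val (map_sub (totD none) Φ Φ')) z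
    have h2 : ∀ i, Dx i ((Ψ i - Ψ' i : DF n) : Jet n → ℝ) z = Dx i (Ψ i) z - Dx i (Ψ' i) z :=
      fun i => congrFun (congrArg Subtype.val (map_sub (totD (some i)) (Ψ i) (Ψ' i))) z
    rw [h1, Finset.sum_congr rfl fun i _ => h2 i, Finset.sum_sub_distrib]
    linarith [h.conserved z hz, h'.conserved z hz]

theorem IsConservationLaw.isTrivial_iff (hn : n ≠ 0) {r : ℕ} {g Φ : DF n} {Ψ : Fin n → DF n}
    (hg : IsNormal (r + 1) (g : Jet n → ℝ))
    (h : IsConservationLaw (r + 1) (g : Jet n → ℝ) Φ fun i => (Ψ i : Jet n → ℝ)) :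
    IsTrivial (r + 1) (g : Jet n → ℝ) Φ (fun i => (Ψ i : Jet n → ℝ)) ↔
      eulerL r (frechet Φ) = 0 :=
  ⟨eulerL_frechet_eq_zero_of_isTrivial hg h.normal_t,
    isTrivial_of_eulerL_frechet_eq_zero hn hg h⟩

end ConsLaw

/-! ### Conservation laws and their multipliers -/

theorem theorem3p2 (n N : ℕ) (hn : 1 ≤ n) (hN : 1 ≤ N)
    (g : ConsLaw.Jet n → ℝ) (hg : ConsLaw.IsNormal N g) :
    -- Every conservation law has exactly one multiplier, given by the restricted Euler operator.
    (∀ (Φt : ConsLaw.Jet n → ℝ) (Φx : Fin n → ConsLaw.Jet n → ℝ),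
      ConsLaw.IsConservationLaw N g Φt Φx →
        ConsLaw.IsMultiplier N g Φt Φx (ConsLaw.restrictedEuler (N - 1) Φt) ∧
        (∀ Λ, ConsLaw.IsMultiplier N g Φt Φx Λ → Λ = ConsLaw.restrictedEuler (N - 1) Φt) ∧
        -- The law is nontrivial exactly if its multiplier is not identically zero.
        (¬ ConsLaw.IsTrivial N g Φt Φx ↔ ConsLaw.restrictedEuler (N - 1) Φt ≠ 0)) ∧
    -- Two laws have the same multiplier exactly if they agree to within trivial densities.
    (∀ (Φt Φt' : ConsLaw.Jet n → ℝ) (Φx Φx' : Fin n → ConsLaw.Jet n → ℝ),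
      ConsLaw.IsConservationLaw N g Φt Φx → ConsLaw.IsConservationLaw N g Φt' Φx' →
        (ConsLaw.SameLaw N g Φt Φx Φt' Φx' ↔
          ConsLaw.restrictedEuler (N - 1) Φt = ConsLaw.restrictedEuler (N - 1) Φt')) := by
  open ConsLaw in
  obtain ⟨r, rfl⟩ : ∃ r, N = r + 1 := ⟨N - 1, by omega⟩
  have hn' : n ≠ 0 := by omega
  lift g to DF n using hg.isDiffFun
  rw [Nat.add_sub_cancel]
  refine ⟨fun Φ Ψ h => ?_, fun Φ Φ' Ψ Ψ' h h' => ?_⟩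
  · lift Φ to DF n using h.normal_t.isDiffFun
    lift Ψ to Fin n → DF n using fun i => (h.normal_x i).isDiffFun
    rw [← coe_eulerL_frechet]
    refine ⟨⟨isNormal_eulerL_frechet h.normal_t, ?_⟩, fun L hL => ?_, not_congr ?_⟩
    · obtain ⟨Γ, hΓ, hid⟩ := exists_multiplier_identity hg h
      refine ⟨fun i => Γ i, fun i => mem_pdeSpan (hΓ i), fun z => ?_⟩
      have := congrFun (congrArg Subtype.val hid) z
      simpa [-map_sub, Finset.sum_apply, tot] using this
    · obtain ⟨hLn, Γ, hΓ, hid⟩ := hL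
      lift L to DF n using hLn.isDiffFun
      lift Γ to Fin n → DF n using fun i => (hΓ i).isDiffFun
      refine congrArg Subtype.val
        (multiplier_unique (Θ := fun i => Ψ i - Γ i) hg h.normal_t hLn (Subtype.ext ?_))
      funext z
      simpa [-map_sub, Finset.sum_apply, tot] using hid z
    · rw [h.isTrivial_iff hn' hg]
      exact Subtype.ext_iff
  · lift Φ to DF n using h.normal_t.isDiffFun
    lift Ψ to Fin n → DF n using fun i => (h.normal_x i).isDiffFun
    lift Φ' to DF n using h'.normal_t.isDiffFun
    lift Ψ' to Fin n → DF n using fun i => (h'.normal_x i).isDiffFun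
    rw [← coe_eulerL_frechet, ← coe_eulerL_frechet]
    -- The difference of the two laws is a conservation law, and the Euler operator is linear.
    refine ((h.sub h').isTrivial_iff hn' hg).trans ?_
    rw [map_sub, map_sub, sub_eq_zero]
    exact Subtype.ext_iff
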